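/- **Blagoveščenskiĭ identity for the elastic wave equation.** Let $d\ge 3$, let $\Omega\subset\mathbb R^d$ be a compact set with $C^1$ boundary and outward unit normal $\nu$, let $\rho\in C^\infty(\Omega)$ with $\rho>0$ and $\mu,\lambda\in C^1(\Omega)$ with $\mu>0$ and $d\lambda+2\mu>0$, and let $T>0$. For $S>0$ and boundary data $f$ on $(0,S)\times\partial\Omega$ let $u_f\in C([0,S];H^1(\Omega)^d)\cap C^1([0,S];L^2(\Omega)^d)$ be the weak solution of $$\rho\,\partial_t^2u-\nabla\cdot\big(\mu(\nabla u+\nabla u^\top)\big)-\nabla(\lambda\nabla\cdot u)=0\ \text{ in }(0,S)\times\Omega,\qquad u|_{t=0}=\partial_tu|_{t=0}=0,\qquad u=f\ \text{ on }(0,S)\times\partial\Omega,$$ and let $\Lambda_{\rho,S}f=\mu\,\partial_\nu u_f+\mu(\nabla u_f)^\top\nu+\lambda(\nabla\cdot u_f)\nu\in L^2((0,S)\times\partial\Omega)^d$ be its surface traction, in the weak sense given by Green's formula. For data $F\in L^2((0,S)\times\partial\Omega)^d$ that may jump in time, $\Lambda_{\rho,S}F$ denotes the distributional time derivative of $N_F:=\Lambda_{\rho,S}\big(\int_0^tF(s,\cdot)\,ds\big)$.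 Let $\Theta$ be the extension by zero from $(0,T)$ to $(0,2T)$, and $$\mathscr B g(t,\cdot)=\tfrac12\int_t^{2T-t}g(s,\cdot)\,ds,\quad t\in(0,T),\qquad\text{so that}\qquad \mathscr B\Lambda_{\rho,2T}F(t,\cdot)=\tfrac12\big(N_F(2T-t,\cdot)-N_F(t,\cdot)\big)$$ for data $F$ on $(0,2T)\times\partial\Omega$. Let $\Lambda_{\rho,T}^*$ be the adjoint in $L^2((0,T)\times\partial\Omega)^d$: $\Lambda_{\rho,T}^*g=\kappa$ means $\kappa\in L^2$ and $\langle\Lambda_{\rho,T}\varphi,g\rangle=\langle\varphi,\kappa\rangle$ for all smooth $\varphi$ with $\varphi(0,\cdot)=0$ (in the domain of $\Lambda_{\rho,T}$). Set $$\mathcal J(\Lambda_{\rho,2T}):=\Lambda_{\rho,T}^*\mathscr B\Theta-\mathscr B\Lambda_{\rho,2T}\Theta .$$ Let $f,h$ be $\mathbb R^d$-valued and smooth on $[0,T]\times\partial\Omega$ (restrictions of smooth functions on $\mathbb R\times\mathbb R^d$) with $f(0,\cdot)=h(0,\cdot)=0$ on $\partial\Omega$, and let $u_f,u_h$ be the corresponding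 weak solutions on $(0,T)\times\Omega$, $\Lambda_{\rho,T}f$ the traction of $u_f$, and $\mathcal J(\Lambda_{\rho,2T})h$ as above. (The existence of these solutions, of their $L^2$ tractions and of $\mathcal J(\Lambda_{\rho,2T})h$ is the underlying well-posedness theory and is not part of the claim.) Then $$\int_\Omega u_f(T)\cdot u_h(T)\,\rho\,dx=\int_0^T\!\!\int_{\partial\Omega}f\cdot\mathcal J(\Lambda_{\rho,2T})h\;dS\,dt .$$ -/

import Mathlib

open MeasureTheory Set
open scoped ContDiff

noncomputable section

namespace Elastic

/-- The Euclidean space `ℝ^d`. -/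
abbrev Sp (d : ℕ) := EuclideanSpace ℝ (Fin d)

/-- Linear maps `ℝ^d → ℝ^d`, i.e. `d × d` matrices (values of displacement gradients). -/
abbrev Mat (d : ℕ) := Sp d →L[ℝ] Sp d

/-- The `(i, j)` entry of a matrix; for a displacement gradient this is `∂_j u_i`. -/
def entry {d : ℕ} (A : Mat d) (i j : Fin d) : ℝ := A (EuclideanSpace.single j 1) i

/-- The trace; for a displacement gradient this is `∇ · u`. -/
def tr {d : ℕ} (A : Mat d) : ℝ := ∑ i, entry A i i

/-! ### The domain, its boundary, surface measure, outward normal -/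

/-- `n` is the outward unit normal of `Ω` at `x`: near `x` the set `Ω` is the sublevel set
`{ψ ≤ 0}` of a `C¹` function `ψ` with `∇ψ(x) ≠ 0`, and `n = ∇ψ(x) / |∇ψ(x)|`. -/
def IsOutwardNormalAt {d : ℕ} (Ω : Set (Sp d)) (x n : Sp d) : Prop :=
  ∃ (U : Set (Sp d)) (ψ : Sp d → ℝ), IsOpen U ∧ x ∈ U ∧ ContDiffOn ℝ 1 ψ U ∧
    gradient ψ x ≠ 0 ∧ Ω ∩ U = {y ∈ U | ψ y ≤ 0} ∧
    n = ‖gradient ψ x‖⁻¹ • gradient ψ x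

/-- `Ω` is locally on one side of its boundary, which is a `C¹` hypersurface. -/
def HasC1Boundary {d : ℕ} (Ω : Set (Sp d)) : Prop :=
  ∀ x ∈ frontier Ω, ∃ n, IsOutwardNormalAt Ω x n

/-- The outward unit normal field on `∂Ω` (the vector in `IsOutwardNormalAt` does not depend on the
choice of the defining function). -/
def outwardNormal {d : ℕ} (Ω : Set (Sp d)) (x : Sp d) : Sp d :=
  Classical.epsilon (IsOutwardNormalAt Ω x)

/-- The surface measure `dS` on `∂Ω`: the `(d-1)`-dimensional Hausdorff measure, normalised so that
it agrees with Lebesgue measure on hyperplanes. -/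
def surf {d : ℕ} (Ω : Set (Sp d)) : Measure (Sp d) :=
  (Measure.euclideanHausdorffMeasure (d - 1)).restrict (frontier Ω)

/-- `L²((0, S) × ∂Ω)^d`. -/
def MemL2Bdry {d : ℕ} (Ω : Set (Sp d)) (S : ℝ) (g : ℝ → Sp d → Sp d) : Prop :=
  MemLp (Function.uncurry g) 2 ((volume.restrict (Ioo 0 S)).prod (surf Ω))

/-- `⟨f, g⟩_{L²((0, S) × ∂Ω)} = ∫_0^S ∫_{∂Ω} f · g dS dt`. -/
def bdryInner {d : ℕ} (Ω : Set (Sp d)) (S : ℝ) (f g : ℝ → Sp d → Sp d) : ℝ :=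
  ∫ t in (0 : ℝ)..S, ∫ x, inner ℝ (f t x) (g t x) ∂(surf Ω)

/-! ### Function spaces on `Ω` -/

/-- `L²(Ω)^d`. -/
abbrev L2Vec {d : ℕ} (Ω : Set (Sp d)) := Lp (Sp d) 2 ((volume : Measure (Sp d)).restrict Ω)

/-- `L²(Ω)^{d × d}`. -/
abbrev L2Mat {d : ℕ} (Ω : Set (Sp d)) := Lp (Mat d) 2 ((volume : Measure (Sp d)).restrict Ω)

/-- `v ∈ H¹(Ω)^d` with weak gradient `G` and boundary trace `g ∈ L²(∂Ω)^d`: for every smooth `ψ`,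
`∫_Ω (v_i ∂_j ψ + ∂_j v_i ψ) dx = ∫_{∂Ω} g_i ψ ν_j dS`.
(Test functions supported in the interior of `Ω` show that `G` is the weak gradient; the general
ones determine the trace.) -/
def HasGradTrace {d : ℕ} (Ω : Set (Sp d)) (v : L2Vec Ω) (G : L2Mat Ω) (g : Sp d → Sp d) : Prop :=
  MemLp g 2 (surf Ω) ∧
  ∀ ψ : Sp d → ℝ, ContDiff ℝ ∞ ψ → ∀ i j : Fin d,
    ∫ x in Ω, (v x i * fderiv ℝ ψ x (EuclideanSpace.single j 1) + entry (G x) i j * ψ x) =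
      ∫ x, g x i * ψ x * outwardNormal Ω x j ∂(surf Ω)

/-- `(u, v)_{L²(Ω; ρ dx)} = ∫_Ω (u · v) ρ dx`. -/
def massForm {d : ℕ} (Ω : Set (Sp d)) (ρ : Sp d → ℝ) (u v : L2Vec Ω) : ℝ :=
  ∫ x in Ω, inner ℝ (u x) (v x) * ρ x

/-- The elastic energy form, as a function of the displacement gradients `G = ∇u`, `H = ∇v`:
`∫_Ω μ (∇u + ∇uᵀ) : ∇v + λ (∇ · u) (∇ · v) dx`. -/
def elasticForm {d : ℕ} (Ω : Set (Sp d)) (mu lam : Sp d → ℝ) (G H : L2Mat Ω) : ℝ :=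
  ∫ x in Ω, (mu x * ∑ i, ∑ j, (entry (G x) i j + entry (G x) j i) * entry (H x) i j
    + lam x * tr (G x) * tr (H x))

/-- The density `ρ ∈ C^∞(Ω)` is positive, the Lamé parameters `μ, λ ∈ C¹(Ω)` satisfy `μ > 0` and
`dλ + 2μ > 0`. (On a compact `Ω` these functions are then automatically bounded, and `ρ`, `μ` are
bounded below by positive constants.) -/
structure IsMedium {d : ℕ} (Ω : Set (Sp d)) (ρ mu lam : Sp d → ℝ) : Prop where
  rho_smooth : ContDiffOn ℝ ∞ ρ Ω
  mu_smooth : ContDiffOn ℝ 1 mu Ω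
  lam_smooth : ContDiffOn ℝ 1 lam Ω
  rho_pos : ∀ x ∈ Ω, 0 < ρ x
  mu_pos : ∀ x ∈ Ω, 0 < mu x
  lam_mu_pos : ∀ x ∈ Ω, 0 < (d : ℝ) * lam x + 2 * mu x

/-! ### Weak solutions and surface tractions -/

/-- `u ∈ C([0, S]; H¹(Ω)) ∩ C¹([0, S]; L²(Ω))` with time derivative `u'` and gradient `G`. -/
structure IsEnergyCurve {d : ℕ} (Ω : Set (Sp d)) (S : ℝ) (u u' : ℝ → L2Vec Ω)
    (G : ℝ → L2Mat Ω) : Prop where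
  hasDeriv : ∀ t ∈ Icc 0 S, HasDerivWithinAt u (u' t) (Icc 0 S) t
  cont_deriv : ContinuousOn u' (Icc 0 S)
  cont_grad : ContinuousOn G (Icc 0 S)
  memH1 : ∀ t ∈ Icc 0 S, ∃ g, HasGradTrace Ω (u t) (G t) g

/-- `u` is the (finite energy) weak solution on `(0, S) × Ω` of `∂_t² u - L_ρ u = 0` with zero
initial data and Dirichlet data `f`: it belongs to `C([0, S]; H¹) ∩ C¹([0, S]; L²)`, has trace
`f(t)` at each time, and for all `v ∈ H¹_0(Ω)^d`
`(∂_t u(t), v)_ρ + ∫_0^t a(u(s), v) ds = 0`. -/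
def IsWeakSolution {d : ℕ} (Ω : Set (Sp d)) (ρ mu lam : Sp d → ℝ) (S : ℝ)
    (f : ℝ → Sp d → Sp d) (u : ℝ → L2Vec Ω) : Prop :=
  ∃ (u' : ℝ → L2Vec Ω) (G : ℝ → L2Mat Ω), IsEnergyCurve Ω S u u' G ∧
    u 0 = 0 ∧ u' 0 = 0 ∧
    (∀ t ∈ Icc 0 S, HasGradTrace Ω (u t) (G t) (f t)) ∧
    ∀ t ∈ Icc 0 S, ∀ (v : L2Vec Ω) (Gv : L2Mat Ω), HasGradTrace Ω v Gv 0 →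
      massForm Ω ρ (u' t) v + ∫ s in (0 : ℝ)..t, elasticForm Ω mu lam (G s) Gv = 0

/-- `τ ∈ L²((0, S) × ∂Ω)^d` is the surface traction
`T_ν u = μ ∂_ν u + μ (∇u)ᵀ ν + λ (∇ · u) ν` of the solution `u`, in the weak sense given by Green's
formula: for all `v ∈ H¹(Ω)^d` with trace `g`,
`(∂_t u(t), v)_ρ - (∂_t u(0), v)_ρ + ∫_0^t a(u(s), v) ds = ∫_0^t ∫_{∂Ω} τ(s) · g dS ds`. -/
def IsSurfaceTraction {d : ℕ} (Ω : Set (Sp d)) (ρ mu lam : Sp d → ℝ) (S : ℝ)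
    (u : ℝ → L2Vec Ω) (τ : ℝ → Sp d → Sp d) : Prop :=
  MemL2Bdry Ω S τ ∧
  ∃ (u' : ℝ → L2Vec Ω) (G : ℝ → L2Mat Ω), IsEnergyCurve Ω S u u' G ∧
    ∀ t ∈ Icc 0 S, ∀ (v : L2Vec Ω) (Gv : L2Mat Ω) (g : Sp d → Sp d), HasGradTrace Ω v Gv g →
      massForm Ω ρ (u' t) v - massForm Ω ρ (u' 0) v
          + ∫ s in (0 : ℝ)..t, elasticForm Ω mu lam (G s) Gv
        = ∫ s in (0 : ℝ)..t, ∫ x, inner ℝ (τ s x) (g x) ∂(surf Ω)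

/-- The displacement to traction map `Λ_{ρ,S}` (its graph): `Λ_{ρ,S} f = τ` if the weak solution
on `(0, S) × Ω` with Dirichlet data `f` has the surface traction `τ ∈ L²((0, S) × ∂Ω)^d`. -/
def IsTractionMap {d : ℕ} (Ω : Set (Sp d)) (ρ mu lam : Sp d → ℝ) (S : ℝ)
    (f τ : ℝ → Sp d → Sp d) : Prop :=
  ∃ u, IsWeakSolution Ω ρ mu lam S f u ∧ IsSurfaceTraction Ω ρ mu lam S u τ

/-! ### Boundary sources and operators in time -/

/-- `f ∈ C_0^∞((0, T) × ∂Ω)^d`: on `[0, T] × ∂Ω` the function `f` is the restriction of a smooth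
function on space-time, and `f(0, x) = 0` on `∂Ω`. -/
def IsSource {d : ℕ} (Ω : Set (Sp d)) (T : ℝ) (f : ℝ → Sp d → Sp d) : Prop :=
  (∃ F : ℝ × Sp d → Sp d, ContDiff ℝ ∞ F ∧ ∀ t ∈ Icc 0 T, ∀ x ∈ frontier Ω, f t x = F (t, x)) ∧
  ∀ x ∈ frontier Ω, f 0 x = 0

open Classical in
/-- `Θ`: extension in time by zero from `(0, T)`. -/
def extendZero {d : ℕ} (T : ℝ) (f : ℝ → Sp d → Sp d) : ℝ → Sp d → Sp d :=
  fun t x => if t ∈ Ioo 0 T then f t x else 0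

/-- `B f(t) = (1/2) ∫_t^{2T - t} f(s) ds`. -/
def timeAvg {d : ℕ} (T : ℝ) (f : ℝ → Sp d → Sp d) : ℝ → Sp d → Sp d :=
  fun t x => (1 / 2 : ℝ) • ∫ s in t..(2 * T - t), f s x

/-- The time primitive `∫_0^t f(s) ds`. -/
def timePrimitive {d : ℕ} (f : ℝ → Sp d → Sp d) : ℝ → Sp d → Sp d :=
  fun t x => ∫ s in (0 : ℝ)..t, f s x

/-- `B` applied to the (distributional) time derivative of `N`:
`B ∂_t N (t) = (1/2) (N(2T - t) - N(t))`. -/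
def timeAvgDeriv {d : ℕ} (T : ℝ) (N : ℝ → Sp d → Sp d) : ℝ → Sp d → Sp d :=
  fun t x => (1 / 2 : ℝ) • (N (2 * T - t) x - N t x)

/-- For integrable functions of time, `timeAvgDeriv` of the primitive is `B`. -/
theorem timeAvgDeriv_timePrimitive {d : ℕ} (T : ℝ) (f : ℝ → Sp d → Sp d) (x : Sp d)
    (hf : IntervalIntegrable (fun s => f s x) volume 0 (2 * T)) {t : ℝ} (ht : t ∈ Icc 0 (2 * T)) :
    timeAvgDeriv T (timePrimitive f) t x = timeAvg T f t x := by
  have hT : (0 : ℝ) ≤ 2 * T := ht.1.trans ht.2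
  have h0 : (0 : ℝ) ∈ uIcc 0 (2 * T) := left_mem_uIcc
  have h1 : t ∈ uIcc 0 (2 * T) := by rw [uIcc_of_le hT]; exact ht
  have h2 : 2 * T - t ∈ uIcc 0 (2 * T) := by
    rw [uIcc_of_le hT]; exact ⟨by linarith [ht.2], by linarith [ht.1]⟩
  simp only [timeAvgDeriv, timePrimitive, timeAvg]
  rw [intervalIntegral.integral_interval_sub_left
    (hf.mono_set (uIcc_subset_uIcc h0 h2)) (hf.mono_set (uIcc_subset_uIcc h0 h1))]

/-- `Λ_{ρ,S}` on sources `F ∈ L²((0, S) × ∂Ω)` that may jump in time (such as the extension by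
zero of a smooth source). As the coefficients do not depend on time, `Λ_{ρ,S} F` is the time
derivative of `N = Λ_{ρ,S} (∫_0^t F)`, in the sense of distributions; this relation says that `N`
is that primitive. -/
def IsTractionMapPrimitive {d : ℕ} (Ω : Set (Sp d)) (ρ mu lam : Sp d → ℝ) (S : ℝ)
    (F N : ℝ → Sp d → Sp d) : Prop :=
  IsTractionMap Ω ρ mu lam S (timePrimitive F) N

/-- The graph of the adjoint `Λ*_{ρ,T}` with respect to the inner product of
`L²((0, T) × ∂Ω)^d`: `Λ* g = κ` if `⟨Λ φ, g⟩ = ⟨φ, κ⟩` for all smooth `φ` with `φ(0) = 0`. -/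
def IsTractionMapAdjoint {d : ℕ} (Ω : Set (Sp d)) (ρ mu lam : Sp d → ℝ) (T : ℝ)
    (g κ : ℝ → Sp d → Sp d) : Prop :=
  MemL2Bdry Ω T g ∧ MemL2Bdry Ω T κ ∧
  ∀ φ τ : ℝ → Sp d → Sp d, IsSource Ω T φ → IsTractionMap Ω ρ mu lam T φ τ →
    bdryInner Ω T τ g = bdryInner Ω T φ κ

/-- The graph of `J(Λ_{ρ,2T}) = Λ*_{ρ,T} B Θ - B Λ_{ρ,2T} Θ`: `J(Λ_{ρ,2T}) h = j`. -/
def IsConnectingMap {d : ℕ} (Ω : Set (Sp d)) (ρ mu lam : Sp d → ℝ) (T : ℝ)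
    (h j : ℝ → Sp d → Sp d) : Prop :=
  ∃ κ N : ℝ → Sp d → Sp d,
    IsTractionMapAdjoint Ω ρ mu lam T (timeAvg T (extendZero T h)) κ ∧
    IsTractionMapPrimitive Ω ρ mu lam (2 * T) (extendZero T h) N ∧
    j = κ - timeAvgDeriv T N

end Elastic

end

noncomputable section

namespace Elastic

open Filter Topology Metric
open scoped NNReal RealInnerProductSpace

variable {d : ℕ} {Ω : Set (Sp d)} {ρ mu lam : Sp d → ℝ} {S T : ℝ}

/-! ### Geometry of the boundary -/

/-! Let `w` be the solution on (0, 2T) whose Dirichlet data are the primitive P of Θh, and let N be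
its traction. By uniqueness `w` is the primitive of u_h on [0, T], so w'(T) = u_h(T). The symmetric
Green formula on (0, T) for u_f and `w` gives (u_f'(T), w(T))_ρ − (w'(T), u_f(T))_ρ = ⟨Λf, P⟩ − ⟨f,
N⟩; the terms at time 0 vanish because u_f starts from rest. The reflected curve t ↦ w(2T − t) obeys
the same equation, meets `w` at t = T and has the opposite velocity there, so it gives the formula
with the second term's sign flipped and P, N reflected. Half the difference of the two is (u_f(T),
u_h(T))_ρ = ⟨Λf, BΘh⟩ − ⟨f, B∂_tN⟩, and the adjoint turns ⟨Λf, BΘh⟩ into ⟨f, κ⟩.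

The work lies in the low regularity. Velocities are only continuous into L² and tractions only L²,
so `bilinear_integration_by_parts` obtains the product rule behind `GreenCurve.massForm_sub_eq` from
small time increments instead of derivatives. In the uniqueness proof the velocity is not an
admissible test function; the time-integrated equation is tested with the difference e of two
solutions itself, which conserves m(e, e) + a(Γ, Γ) with Γ the time primitive of the gradient
(`energy_eq_zero`). The geometry of the boundary provides a finite surface measure, a Lebesgue-null
boundary (for `HasGradTrace.grad_unique`) and a continuous normal (for Fubini in
`HasGradTrace.primitive`). -/

theorem eq_zero_of_mem_frontier {U : Set (Sp d)} {ψ : Sp d → ℝ} (hΩ : IsClosed Ω) (hU : IsOpen U)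
    (hψ : ContinuousOn ψ U) (h : Ω ∩ U = {y ∈ U | ψ y ≤ 0}) {y : Sp d} (hy : y ∈ frontier Ω)
    (hyU : y ∈ U) : ψ y = 0 := by
  have hyΩ : y ∈ Ω := hΩ.frontier_subset hy
  have h1 : y ∈ {y ∈ U | ψ y ≤ 0} := h ▸ ⟨hyΩ, hyU⟩
  refine le_antisymm h1.2 ?_
  by_contra! hneg
  have hnhds : ∀ᶠ z in 𝓝 y, z ∈ Ω := by
    filter_upwards [(hψ.continuousAt (hU.mem_nhds hyU)).eventually (gt_mem_nhds hneg),
      hU.mem_nhds hyU] with z hz hzU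
    have : z ∈ Ω ∩ U := h ▸ ⟨hzU, hz.le⟩
    exact this.1
  exact hy.2 (mem_interior_iff_mem_nhds.2 hnhds)

/-- The component of `v` along `n` is at most half of `v`, so Pythagoras bounds `v` by its
tangential part; 2 is a convenient upper bound for 2/√3. -/
theorem norm_le_two_mul_norm_projection {n v : Sp d} (hn : n ≠ 0)
    (h : |⟪n, v⟫| ≤ ‖n‖ / 2 * ‖v‖) :
    ‖v‖ ≤ 2 * ‖(ℝ ∙ n)ᗮ.orthogonalProjectionOnto v‖ := by
  have hpos : 0 < ‖n‖ := norm_pos_iff.2 hn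
  have h1 := (ℝ ∙ n).norm_sq_eq_add_norm_sq_projection v
  have h2 : ‖(ℝ ∙ n).orthogonalProjectionOnto v‖ ≤ ‖v‖ / 2 := by
    rw [Submodule.coe_norm, Submodule.coe_orthogonalProjectionOnto_apply,
      Submodule.starProjection_singleton, norm_smul, Real.norm_eq_abs, abs_div]
    simp only [RCLike.ofReal_real_eq_id, id, abs_pow, abs_norm]
    rw [div_mul_eq_mul_div, div_le_iff₀ (by positivity)]
    calc |⟪n, v⟫| * ‖n‖ ≤ ‖n‖ / 2 * ‖v‖ * ‖n‖ := by gcongr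
      _ = _ := by ring
  have h3 := norm_nonneg ((ℝ ∙ n).orthogonalProjectionOnto v)
  have h4 := norm_nonneg ((ℝ ∙ n)ᗮ.orthogonalProjectionOnto v)
  nlinarith [norm_nonneg v]

/-- Near `x` the tangential projection is injective on the boundary with 2-Lipschitz inverse, so a
boundary patch is a Lipschitz image of a bounded subset of a hyperplane. -/
theorem exists_measure_frontier_inter_lt_top (hd : 1 ≤ d) (hΩ : IsClosed Ω)
    (hbd : HasC1Boundary Ω) {x : Sp d} (hx : x ∈ frontier Ω) :
    ∃ s ∈ 𝓝 x, Measure.euclideanHausdorffMeasure (d - 1) (frontier Ω ∩ s) < ⊤ := by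
  obtain ⟨-, U, ψ, hU, hxU, hψ, hgrad, hset, -⟩ := hbd x hx
  set n := gradient ψ x with hn
  have hψx : ContDiffAt ℝ 1 ψ x := hψ.contDiffAt (hU.mem_nhds hxU)
  have hpos : 0 < ‖n‖ := norm_pos_iff.2 hgrad
  -- Since ψ vanishes at boundary points, strict differentiability with constant ‖n‖/2 bounds ⟪n, y
  -- − z⟫ by (‖n‖/2)‖y − z‖ for any two of them near `x`.
  obtain ⟨s, hs, happ⟩ := (hψx.hasStrictFDerivAt one_ne_zero).approximates_deriv_on_nhds
    (c := ⟨‖n‖ / 2, by positivity⟩) (Or.inr (by exact_mod_cast half_pos hpos))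
  refine ⟨s ∩ U ∩ ball x 1, inter_mem (inter_mem hs (hU.mem_nhds hxU)) (ball_mem_nhds x one_pos),
    ?_⟩
  set A := frontier Ω ∩ (s ∩ U ∩ ball x 1)
  set P := (ℝ ∙ n)ᗮ.orthogonalProjectionOnto
  have hanti : ∀ y ∈ A, ∀ z ∈ A, dist y z ≤ 2 * dist (P y) (P z) := by
    intro y hy z hz
    have h1 := happ y hy.2.1.1 z hz.2.1.1
    rw [eq_zero_of_mem_frontier hΩ hU hψ.continuousOn hset hy.1 hy.2.1.2,
      eq_zero_of_mem_frontier hΩ hU hψ.continuousOn hset hz.1 hz.2.1.2, sub_zero, zero_sub,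
      norm_neg, ← inner_gradient_left, ← hn] at h1
    rw [dist_eq_norm, dist_eq_norm, ← map_sub]
    exact norm_le_two_mul_norm_projection hgrad h1
  have hinj : InjOn P A := by
    intro y hy z hz hyz
    have := hanti y hy z hz
    rw [hyz, dist_self, mul_zero] at this
    exact dist_le_zero.1 this
  have hlip : LipschitzOnWith 2 (Function.invFunOn P A) (P '' A) := by
    refine LipschitzOnWith.of_dist_le_mul ?_
    rintro _ ⟨y, hy, rfl⟩ _ ⟨z, hz, rfl⟩
    rw [hinj.leftInvOn_invFunOn hy, hinj.leftInvOn_invFunOn hz]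
    exact hanti y hy z hz
  have hfin : Module.finrank ℝ (ℝ ∙ n)ᗮ = d - 1 := by
    have h1 := (ℝ ∙ n).finrank_add_finrank_orthogonal
    rw [finrank_span_singleton hgrad, finrank_euclideanSpace_fin] at h1
    omega
  -- On the (d−1)-dimensional complement the Hausdorff measure is a Haar measure, finite on bounded
  -- sets; the unit ball was included in the neighbourhood to make the image bounded.
  have hPA : μH[((d - 1 : ℕ) : ℝ)] (P '' A) < ⊤ := by
    have hb : Bornology.IsBounded (P '' A) :=
      P.lipschitz.isBounded_image (isBounded_ball.subset fun y hy => hy.2.2)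
    rw [← hfin]
    have := isAddHaarMeasure_hausdorffMeasure (E := (ℝ ∙ n)ᗮ)
    exact hb.measure_lt_top
  have hA := hlip.hausdorffMeasure_image_le (d := ((d - 1 : ℕ) : ℝ)) (by positivity)
  rw [hinj.invFunOn_image Subset.rfl] at hA
  rw [Measure.euclideanHausdorffMeasure_def, Measure.smul_apply]
  refine ENNReal.mul_lt_top ENNReal.coe_lt_top (hA.trans_lt (ENNReal.mul_lt_top ?_ hPA))
  exact ENNReal.rpow_lt_top_of_nonneg (by positivity) ENNReal.coe_ne_top

theorem isCompact_frontier (hΩ : IsCompact Ω) : IsCompact (frontier Ω) :=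
  hΩ.of_isClosed_subset isClosed_frontier hΩ.isClosed.frontier_subset

theorem measure_frontier_lt_top (hd : 1 ≤ d) (hΩ : IsCompact Ω) (hbd : HasC1Boundary Ω) :
    Measure.euclideanHausdorffMeasure (d - 1) (frontier Ω) < ⊤ := by
  refine (isCompact_frontier hΩ).measure_lt_top_of_nhdsWithin fun x hx => ?_
  obtain ⟨s, hs, h⟩ := exists_measure_frontier_inter_lt_top hd hΩ.isClosed hbd hx
  exact ⟨_, inter_mem self_mem_nhdsWithin (mem_nhdsWithin_of_mem_nhds hs), h⟩

theorem isFiniteMeasure_surf (hd : 1 ≤ d) (hΩ : IsCompact Ω) (hbd : HasC1Boundary Ω) :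
    IsFiniteMeasure (surf Ω) :=
  ⟨by simpa [surf] using measure_frontier_lt_top hd hΩ hbd⟩

/-- A set of finite (d−1)-dimensional measure is null in dimension d. -/
theorem volume_frontier_eq_zero (hd : 1 ≤ d) (hΩ : IsCompact Ω) (hbd : HasC1Boundary Ω) :
    volume (frontier Ω) = 0 := by
  rw [← EuclideanSpace.euclideanHausdorffMeasure_eq_volume]
  exact (Measure.euclideanHausdorffMeasure_zero_or_top (show d - 1 < d by omega)
    (frontier Ω)).resolve_right (measure_frontier_lt_top hd hΩ hbd).ne

/-- A direction in which ψ strictly decreases enters Ω for small positive times; there φ is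
nonpositive as well, hence so is its one-sided slope from the value 0. -/
theorem inner_gradient_nonpos_of_neg {U V : Set (Sp d)} {ψ φ : Sp d → ℝ} {x v : Sp d}
    (hΩ : IsClosed Ω) (hx : x ∈ frontier Ω)
    (hU : IsOpen U) (hxU : x ∈ U) (hψ : ContDiffOn ℝ 1 ψ U) (hΩU : Ω ∩ U = {y ∈ U | ψ y ≤ 0})
    (hV : IsOpen V) (hxV : x ∈ V) (hφ : ContDiffOn ℝ 1 φ V) (hΩV : Ω ∩ V = {y ∈ V | φ y ≤ 0})
    (hv : ⟪gradient ψ x, v⟫ < 0) : ⟪gradient φ x, v⟫ ≤ 0 := by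
  have key : ∀ {W : Set (Sp d)} {χ : Sp d → ℝ}, IsOpen W → x ∈ W → ContDiffOn ℝ 1 χ W →
      Ω ∩ W = {y ∈ W | χ y ≤ 0} →
      Tendsto (fun t : ℝ => t⁻¹ • χ (x + t • v)) (𝓝[>] 0) (𝓝 ⟪gradient χ x, v⟫) := by
    intro W χ hW hxW hχ hΩW
    have h0 := eq_zero_of_mem_frontier hΩ hW hχ.continuousOn hΩW hx hxW
    have h1 := ((hχ.contDiffAt (hW.mem_nhds hxW)).differentiableAt one_ne_zero).hasFDerivAt
    have h2 := (h1.hasLineDerivAt v).tendsto_slope_zero_right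
    rw [inner_gradient_left]
    simpa [h0] using h2
  have hline : Tendsto (fun t : ℝ => x + t • v) (𝓝[>] 0) (𝓝 x) := by
    have : Continuous fun t : ℝ => x + t • v := by fun_prop
    simpa using (this.tendsto 0).mono_left nhdsWithin_le_nhds
  refine le_of_tendsto (key hV hxV hφ hΩV) ?_
  filter_upwards [(key hU hxU hψ hΩU).eventually (gt_mem_nhds hv), self_mem_nhdsWithin,
    hline (hU.mem_nhds hxU), hline (hV.mem_nhds hxV)] with t ht (ht0 : 0 < t) htU htV
  have h1 : ψ (x + t • v) ≤ 0 := by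
    by_contra! h
    exact absurd ht (not_lt.2 (smul_nonneg (inv_nonneg.2 ht0.le) h.le))
  have h2 : x + t • v ∈ Ω ∩ U := hΩU ▸ ⟨htU, h1⟩
  have h3 : x + t • v ∈ {y ∈ V | φ y ≤ 0} := hΩV ▸ ⟨h2.1, htV⟩
  exact smul_nonpos_of_nonneg_of_nonpos (inv_nonneg.2 ht0.le) h3.2

theorem normalize_eq_of_forall_inner {a b : Sp d} (ha : a ≠ 0) (hb : b ≠ 0)
    (h : ∀ v, ⟪a, v⟫ < 0 → ⟪b, v⟫ ≤ 0) : ‖a‖⁻¹ • a = ‖b‖⁻¹ • b := by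
  have ha' : 0 < ‖a‖ := norm_pos_iff.2 ha
  have hb' : 0 < ‖b‖ := norm_pos_iff.2 hb
  have h1 : ‖a‖ * ‖b‖ ≤ ⟪a, b⟫ := by
    by_contra! hlt
    -- If Cauchy–Schwarz were strict, this vector would have negative product with `a` and positive
    -- product with `b`.
    have h2 := h (‖a‖ • b - ‖b‖ • a) (by
      rw [inner_sub_right, real_inner_smul_right, real_inner_smul_right,
        real_inner_self_eq_norm_sq]
      nlinarith)
    rw [inner_sub_right, real_inner_smul_right, real_inner_smul_right,
      real_inner_self_eq_norm_sq, real_inner_comm] at h2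
    nlinarith
  have h2 := inner_eq_norm_mul_iff_real.1 (le_antisymm (real_inner_le_norm a b) h1)
  rw [inv_smul_eq_iff₀ ha'.ne', smul_comm, eq_comm, inv_smul_eq_iff₀ hb'.ne']
  exact h2.symm

theorem IsOutwardNormalAt.unique {x n n' : Sp d} (hΩ : IsClosed Ω) (hx : x ∈ frontier Ω)
    (h : IsOutwardNormalAt Ω x n) (h' : IsOutwardNormalAt Ω x n') : n = n' := by
  obtain ⟨U, ψ, hU, hxU, hψ, hgrad, hset, rfl⟩ := h
  obtain ⟨V, φ, hV, hxV, hφ, hgrad', hset', rfl⟩ := h'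
  exact normalize_eq_of_forall_inner hgrad hgrad' fun v =>
    inner_gradient_nonpos_of_neg hΩ hx hU hxU hψ hset hV hxV hφ hset'

/-- One defining function serves all boundary points near `x`, so by uniqueness the normal there is
its normalised gradient, whatever `Classical.epsilon` selects. -/
theorem continuousOn_outwardNormal (hΩ : IsClosed Ω) (hbd : HasC1Boundary Ω) :
    ContinuousOn (outwardNormal Ω) (frontier Ω) := by
  intro x hx
  obtain ⟨-, U, ψ, hU, hxU, hψ, hgrad, hset, -⟩ := hbd x hx
  have hcont : ContinuousAt (gradient ψ) x :=
    (InnerProductSpace.toDual ℝ (Sp d)).symm.continuous.continuousAt.comp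
      ((hψ.contDiffAt (hU.mem_nhds hxU)).continuousAt_fderiv one_ne_zero)
  have h1 : ContinuousAt (fun y => ‖gradient ψ y‖⁻¹ • gradient ψ y) x :=
    (hcont.norm.inv₀ (norm_ne_zero_iff.2 hgrad)).smul hcont
  refine h1.continuousWithinAt.congr_of_eventuallyEq_of_mem ?_ hx
  filter_upwards [self_mem_nhdsWithin, mem_nhdsWithin_of_mem_nhds (hU.mem_nhds hxU),
    mem_nhdsWithin_of_mem_nhds (hcont.eventually_ne hgrad)] with y hy hyU hyn
  exact (Classical.epsilon_spec (hbd y hy)).unique hΩ hy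
    ⟨U, ψ, hU, hyU, hψ, hyn, hset, rfl⟩

/-! ### The bilinear forms -/

section Pairing

variable {X E F : Type*} {mX : MeasurableSpace X} {μ : Measure X}
  [NormedAddCommGroup E] [NormedSpace ℝ E] [NormedAddCommGroup F] [NormedSpace ℝ F]

/-- The bilinear form `(u, v) ↦ ∫ c B(u, v) dμ` on `L²`, for a bounded weight `c`. -/
def weightedPairing {c : X → ℝ} (hc : MemLp c ⊤ μ) (B : E →L[ℝ] F →L[ℝ] ℝ) :
    Lp E 2 μ →L[ℝ] Lp F 2 μ →L[ℝ] ℝ :=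
  (B.lpPairing μ 2 2).comp ((ContinuousLinearMap.lsmul ℝ ℝ).holderL μ ⊤ 2 2 hc.toLp)

theorem weightedPairing_apply {c : X → ℝ} (hc : MemLp c ⊤ μ) (B : E →L[ℝ] F →L[ℝ] ℝ)
    (u : Lp E 2 μ) (v : Lp F 2 μ) :
    weightedPairing hc B u v = ∫ x, c x * B (u x) (v x) ∂μ := by
  rw [weightedPairing, ContinuousLinearMap.comp_apply, ContinuousLinearMap.lpPairing_eq_integral]
  refine integral_congr_ae ?_
  filter_upwards [(ContinuousLinearMap.lsmul ℝ ℝ (E := E)).coeFn_holder (r := 2) hc.toLp u,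
    hc.coeFn_toLp] with x hx hcx
  rw [ContinuousLinearMap.holderL_apply_apply, hx, hcx]
  simp

theorem integrable_weightedPairing {c : X → ℝ} (hc : MemLp c ⊤ μ) (B : E →L[ℝ] F →L[ℝ] ℝ)
    (u : Lp E 2 μ) (v : Lp F 2 μ) : Integrable (fun x => c x * B (u x) (v x)) μ :=
  memLp_one_iff_integrable.1
    ((B.memLp_of_bilin 1 (Lp.memLp u) (Lp.memLp v)).mul hc)

end Pairing

theorem memLp_top_of_continuousOn (hΩ : IsCompact Ω) {c : Sp d → ℝ} (hc : ContinuousOn c Ω) :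
    MemLp c ⊤ (volume.restrict Ω) := by
  obtain ⟨C, hC⟩ := hΩ.exists_bound_of_continuousOn hc
  exact memLp_top_of_bound (hc.aestronglyMeasurable hΩ.measurableSet) C
    ((ae_restrict_iff' hΩ.measurableSet).2 (.of_forall hC))

/-- The `(i, j)` entry as a continuous linear functional. -/
def entryL (i j : Fin d) : Mat d →L[ℝ] ℝ :=
  (EuclideanSpace.proj i).comp (ContinuousLinearMap.apply ℝ (Sp d) (EuclideanSpace.single j 1))

theorem entryL_apply (i j : Fin d) (A : Mat d) : entryL i j A = entry A i j := rfl

/-- The trace as a continuous linear functional. -/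
def trL : Mat d →L[ℝ] ℝ := ∑ i, entryL i i

theorem trL_apply (A : Mat d) : trL A = tr A := by simp [trL, tr, entryL_apply]

/-- The bilinear form `(x, y) ↦ ∑ i j, (e i j x + e j i x) e i j y`. -/
def symmetricPairing {E : Type*} [NormedAddCommGroup E] [NormedSpace ℝ E]
    (e : Fin d → Fin d → E →L[ℝ] ℝ) : E →L[ℝ] E →L[ℝ] ℝ :=
  ∑ i, ∑ j, (ContinuousLinearMap.mul ℝ ℝ).bilinearComp (e i j + e j i) (e i j)

theorem symmetricPairing_apply {E : Type*} [NormedAddCommGroup E] [NormedSpace ℝ E]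
    (e : Fin d → Fin d → E →L[ℝ] ℝ) (x y : E) :
    symmetricPairing e x y = ∑ i, ∑ j, (e i j x + e j i x) * e i j y := by
  simp [symmetricPairing, add_mul]

/-- The bilinear form `(A, H) ↦ (A + Aᵀ) : H`. -/
def strainL : Mat d →L[ℝ] Mat d →L[ℝ] ℝ := symmetricPairing entryL

theorem strainL_apply (A H : Mat d) :
    strainL A H = ∑ i, ∑ j, (entry A i j + entry A j i) * entry H i j :=
  symmetricPairing_apply entryL A H

/-- The bilinear form `(A, H) ↦ (tr A) (tr H)`. -/
def trTrL : Mat d →L[ℝ] Mat d →L[ℝ] ℝ := (ContinuousLinearMap.mul ℝ ℝ).bilinearComp trL trL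

theorem trTrL_apply (A H : Mat d) : trTrL A H = tr A * tr H := by
  simp [trTrL, trL_apply]

/-- The Euclidean inner product as a bilinear form. -/
def innerL : Sp d →L[ℝ] Sp d →L[ℝ] ℝ := innerSL ℝ

theorem innerL_apply (v w : Sp d) : innerL v w = inner ℝ v w := rfl

theorem exists_massForm_eq (hΩ : IsCompact Ω) (hmed : IsMedium Ω ρ mu lam) :
    ∃ m : L2Vec Ω →L[ℝ] L2Vec Ω →L[ℝ] ℝ, ∀ u v, massForm Ω ρ u v = m u v := by
  refine ⟨weightedPairing (memLp_top_of_continuousOn hΩ hmed.rho_smooth.continuousOn)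
    innerL, fun u v => ?_⟩
  rw [weightedPairing_apply]
  simp only [massForm, innerL_apply, mul_comm]

theorem exists_elasticForm_eq (hΩ : IsCompact Ω) (hmed : IsMedium Ω ρ mu lam) :
    ∃ a : L2Mat Ω →L[ℝ] L2Mat Ω →L[ℝ] ℝ, ∀ G H, elasticForm Ω mu lam G H = a G H := by
  have hm := memLp_top_of_continuousOn hΩ hmed.mu_smooth.continuousOn
  have hl := memLp_top_of_continuousOn hΩ hmed.lam_smooth.continuousOn
  refine ⟨weightedPairing hm strainL + weightedPairing hl trTrL, fun G H => ?_⟩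
  rw [add_apply, add_apply, weightedPairing_apply,
    weightedPairing_apply, ← integral_add (integrable_weightedPairing hm _ _ _)
      (integrable_weightedPairing hl _ _ _)]
  simp [elasticForm, strainL_apply, trTrL_apply, mul_assoc]

theorem massForm_comm (u v : L2Vec Ω) : massForm Ω ρ u v = massForm Ω ρ v u := by
  simp only [massForm, real_inner_comm]

theorem strain_comm (A H : Mat d) :
    ∑ i, ∑ j, (entry A i j + entry A j i) * entry H i j =
      ∑ i, ∑ j, (entry H i j + entry H j i) * entry A i j := by
  simp only [add_mul, Finset.sum_add_distrib]
  congr 1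
  · simp only [mul_comm]
  · rw [Finset.sum_comm]
    simp only [mul_comm]

theorem elasticForm_comm (G H : L2Mat Ω) :
    elasticForm Ω mu lam G H = elasticForm Ω mu lam H G := by
  simp only [elasticForm, strain_comm (G _) (H _), mul_right_comm (lam _)]

/-- The right-hand sum equals ½|A + Aᵀ|². Keeping only its diagonal terms and applying
Cauchy–Schwarz to the trace gives the bound, with exactly the constant that matches the condition dλ
+ 2μ > 0. -/
theorem tr_sq_le (A : Mat d) :
    2 * tr A ^ 2 ≤ d * ∑ i, ∑ j, (entry A i j + entry A j i) * entry A i j := by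
  have h1 : ∑ i, ∑ j, (entry A i j + entry A j i) * entry A i j =
      ∑ i, ∑ j, (entry A i j + entry A j i) ^ 2 / 2 := by
    have h2 : ∑ i, ∑ j, (entry A i j + entry A j i) * entry A i j =
        ∑ i, ∑ j, (entry A i j + entry A j i) * entry A j i := by
      rw [Finset.sum_comm]
      simp only [add_comm]
    have h3 : ∑ i, ∑ j, (entry A i j + entry A j i) ^ 2 / 2 =
        (∑ i, ∑ j, (entry A i j + entry A j i) * entry A i j +
          ∑ i, ∑ j, (entry A i j + entry A j i) * entry A j i) / 2 := by
      rw [← Finset.sum_add_distrib, Finset.sum_div]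
      refine Finset.sum_congr rfl fun i _ => ?_
      rw [← Finset.sum_add_distrib, Finset.sum_div]
      refine Finset.sum_congr rfl fun j _ => ?_
      ring
    rw [h3, ← h2]
    ring
  have h4 : 2 * ∑ i, entry A i i ^ 2 ≤ ∑ i, ∑ j, (entry A i j + entry A j i) ^ 2 / 2 := by
    rw [Finset.mul_sum]
    refine Finset.sum_le_sum fun i _ => ?_
    have : (entry A i i + entry A i i) ^ 2 / 2 ≤ ∑ j, (entry A i j + entry A j i) ^ 2 / 2 :=
      Finset.single_le_sum (f := fun j => (entry A i j + entry A j i) ^ 2 / 2)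
        (fun j _ => by positivity) (Finset.mem_univ i)
    linarith
  have h5 : tr A ^ 2 ≤ d * ∑ i, entry A i i ^ 2 := by
    simpa [tr] using sq_sum_le_card_mul_sum_sq (s := Finset.univ) (f := fun i => entry A i i)
  rw [h1]
  nlinarith [(Nat.cast_nonneg d : (0 : ℝ) ≤ d)]

theorem elasticForm_self_nonneg (hd : 1 ≤ d) (hΩ : IsCompact Ω) (hmed : IsMedium Ω ρ mu lam)
    (G : L2Mat Ω) : 0 ≤ elasticForm Ω mu lam G G := by
  refine setIntegral_nonneg hΩ.measurableSet fun x hx => ?_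
  have h1 := tr_sq_le (G x)
  have h2 := hmed.mu_pos x hx
  have h3 := hmed.lam_mu_pos x hx
  have hd' : (0 : ℝ) < d := by exact_mod_cast hd
  have h4 := mul_le_mul_of_nonneg_left h1 h2.le
  have h5 := mul_nonneg h3.le (sq_nonneg (tr (G x)))
  -- After multiplication by d the integrand is at least (2μ + dλ)(tr G)².
  refine nonneg_of_mul_nonneg_right (a := (d : ℝ)) ?_ hd'
  nlinarith

theorem eq_zero_of_massForm_self_nonpos (hΩ : IsCompact Ω) (hmed : IsMedium Ω ρ mu lam)
    {u : L2Vec Ω} (h : massForm Ω ρ u u ≤ 0) : u = 0 := by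
  have hρ := memLp_top_of_continuousOn hΩ hmed.rho_smooth.continuousOn
  have hint : Integrable (fun x => inner ℝ (u x) (u x) * ρ x) (volume.restrict Ω) := by
    simpa only [innerL_apply, mul_comm] using integrable_weightedPairing hρ innerL u u
  have hmem : ∀ᵐ x ∂(volume.restrict Ω), x ∈ Ω := ae_restrict_mem hΩ.measurableSet
  have hnn : 0 ≤ᵐ[volume.restrict Ω] fun x => inner ℝ (u x) (u x) * ρ x := by
    filter_upwards [hmem] with x hx
    exact mul_nonneg real_inner_self_nonneg (hmed.rho_pos x hx).le
  have h0 := (integral_eq_zero_iff_of_nonneg_ae hnn hint).1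
    (le_antisymm h (integral_nonneg_of_ae hnn))
  refine Lp.ext ?_
  filter_upwards [h0, hmem, Lp.coeFn_zero (Sp d) 2 (volume.restrict Ω)] with x hx hxΩ hz
  rw [hz]
  exact inner_self_eq_zero.1 ((mul_eq_zero.1 hx).resolve_right (hmed.rho_pos x hxΩ).ne')

/-- The left-hand side of the Green identity in `HasGradTrace` is continuous and linear. -/
theorem exists_gradTrace_functional (hΩ : IsCompact Ω) {ψ : Sp d → ℝ} (hψ : ContDiff ℝ ∞ ψ)
    (i j : Fin d) : ∃ (ℓ : L2Vec Ω →L[ℝ] ℝ) (k : L2Mat Ω →L[ℝ] ℝ), ∀ v G,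
      ∫ x in Ω, (v x i * fderiv ℝ ψ x (EuclideanSpace.single j 1) + entry (G x) i j * ψ x) =
        ℓ v + k G := by
  have hfin : IsFiniteMeasure ((volume : Measure (Sp d)).restrict Ω) :=
    ⟨by simpa using hΩ.measure_lt_top⟩
  have h1 : MemLp (fun x => fderiv ℝ ψ x (EuclideanSpace.single j 1)) ⊤ (volume.restrict Ω) :=
    memLp_top_of_continuousOn hΩ
      ((hψ.continuous_fderiv (by simp)).clm_apply continuous_const).continuousOn
  have h2 : MemLp ψ ⊤ (volume.restrict Ω) :=
    memLp_top_of_continuousOn hΩ hψ.continuous.continuousOn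
  -- Pairing with the constant 1 turns the bilinear `weightedPairing` into a linear functional; 1 is
  -- in L² because Ω has finite volume.
  let one : Lp ℝ 2 (volume.restrict Ω) := Lp.const 2 (volume.restrict Ω) (1 : ℝ)
  have hone : ∀ᵐ x ∂(volume.restrict Ω), one x = 1 := Lp.coeFn_const 2 (volume.restrict Ω) (1 : ℝ)
  let B1 : Sp d →L[ℝ] ℝ →L[ℝ] ℝ := (ContinuousLinearMap.mul ℝ ℝ).comp (EuclideanSpace.proj i)
  let B2 : Mat d →L[ℝ] ℝ →L[ℝ] ℝ := (ContinuousLinearMap.mul ℝ ℝ).comp (entryL i j)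
  refine ⟨(weightedPairing h1 B1).flip one, (weightedPairing h2 B2).flip one, fun v G => ?_⟩
  rw [ContinuousLinearMap.flip_apply, ContinuousLinearMap.flip_apply, weightedPairing_apply,
    weightedPairing_apply, ← integral_add (integrable_weightedPairing h1 _ _ _)
      (integrable_weightedPairing h2 _ _ _)]
  refine integral_congr_ae ?_
  filter_upwards [hone] with x hx
  simp only [hx, B1, B2, ContinuousLinearMap.comp_apply, ContinuousLinearMap.mul_apply',
    entryL_apply, mul_one, EuclideanSpace.coe_proj]
  ring

/-! ### Curves on a compact interval -/

theorem hasDerivWithinAt_integral_Icc {E : Type*} [NormedAddCommGroup E] [NormedSpace ℝ E]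
    [CompleteSpace E] {g : ℝ → E} {S t : ℝ} (hg : ContinuousOn g (Icc 0 S)) (ht : t ∈ Icc 0 S) :
    HasDerivWithinAt (fun r => ∫ s in (0 : ℝ)..r, g s) (g t) (Icc 0 S) t := by
  have hS : 0 ≤ S := ht.1.trans ht.2
  -- Extending `g` by its endpoint values makes the usual fundamental theorem available at 0 and S
  -- too.
  have hc : Continuous fun s => g (projIcc 0 S hS s) :=
    hg.comp_continuous (continuous_subtype_val.comp continuous_projIcc) fun s => Subtype.coe_prop _
  have heq : ∀ s ∈ Icc 0 S, g (projIcc 0 S hS s) = g s := fun s hs => by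
    rw [projIcc_of_mem hS hs]
  have h1 := (hc.integral_hasStrictDerivAt 0 t).hasDerivAt.hasDerivWithinAt (s := Icc 0 S)
  rw [heq t ht] at h1
  refine h1.congr_of_mem (fun r hr => ?_) ht
  refine intervalIntegral.integral_congr fun s hs => (heq s ?_).symm
  rw [uIcc_of_le hr.1] at hs
  exact ⟨hs.1, hs.2.trans hr.2⟩

theorem intervalIntegrable_of_continuousOn_Icc {E : Type*} [NormedAddCommGroup E] {g : ℝ → E}
    {S s t : ℝ} (hg : ContinuousOn g (Icc 0 S)) (hs : s ∈ Icc 0 S) (ht : t ∈ Icc 0 S) :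
    IntervalIntegrable g volume s t :=
  (hg.mono (uIcc_subset_Icc hs ht)).intervalIntegrable

theorem eq_zero_of_hasDerivWithinAt_zero {Q : ℝ → ℝ} {S : ℝ}
    (hQ : ∀ t ∈ Icc 0 S, HasDerivWithinAt Q 0 (Icc 0 S) t) (h0 : Q 0 = 0) {t : ℝ}
    (ht : t ∈ Icc 0 S) : Q t = 0 := by
  rw [← h0]
  refine constant_of_derivWithin_zero (fun r hr => (hQ r hr).differentiableWithinAt)
    (fun r hr => ?_) t ht
  exact (hQ r (Ico_subset_Icc_self hr)).derivWithin
    (uniqueDiffOn_Icc (hr.1.trans_lt hr.2) r (Ico_subset_Icc_self hr))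

section Bilinear

variable {E F : Type*} [NormedAddCommGroup E] [NormedSpace ℝ E] [NormedAddCommGroup F]
  [NormedSpace ℝ F] [CompleteSpace F]

theorem integral_bilinear_left (a : F →L[ℝ] F →L[ℝ] ℝ) {G : ℝ → F} {s t : ℝ}
    (hG : IntervalIntegrable G volume s t) (H : F) :
    ∫ r in s..t, a (G r) H = a (∫ r in s..t, G r) H :=
  (a.flip H).intervalIntegral_comp_comm hG

/-- Conservation of the energy `m(e, e) + a(Γ, Γ)`, where `Γ` is the primitive of `G`. -/
theorem energy_eq_zero {m : E →L[ℝ] E →L[ℝ] ℝ} {a : F →L[ℝ] F →L[ℝ] ℝ}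
    (hm : ∀ u v, m u v = m v u) (ha : ∀ G H, a G H = a H G)
    {e e' : ℝ → E} {G : ℝ → F} (he : ∀ t ∈ Icc 0 S, HasDerivWithinAt e (e' t) (Icc 0 S) t)
    (hG : ContinuousOn G (Icc 0 S)) (h0 : e 0 = 0)
    (hweak : ∀ t ∈ Icc 0 S, m (e' t) (e t) + ∫ s in (0 : ℝ)..t, a (G s) (G t) = 0)
    {t : ℝ} (ht : t ∈ Icc 0 S) :
    m (e t) (e t) + a (∫ s in (0 : ℝ)..t, G s) (∫ s in (0 : ℝ)..t, G s) = 0 := by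
  have h0mem : (0 : ℝ) ∈ Icc 0 S := ⟨le_rfl, ht.1.trans ht.2⟩
  refine eq_zero_of_hasDerivWithinAt_zero
    (Q := fun r => m (e r) (e r) + a (∫ s in (0 : ℝ)..r, G s) (∫ s in (0 : ℝ)..r, G s))
    (fun r hr => ?_) (by simp [h0]) ht
  have hΓ := hasDerivWithinAt_integral_Icc hG hr
  have h1 := (m.hasDerivWithinAt_of_bilinear (he r hr) (he r hr)).add
    (a.hasDerivWithinAt_of_bilinear hΓ hΓ)
  refine h1.congr_deriv ?_
  have h2 := hweak r hr
  rw [integral_bilinear_left a (intervalIntegrable_of_continuousOn_Icc hG h0mem hr)] at h2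
  rw [hm (e r), ha (G r)]
  linarith

/-- The time primitive of a solution of the weak equation is a solution. -/
theorem weak_equation_primitive {m : E →L[ℝ] E →L[ℝ] ℝ} {a : F →L[ℝ] F →L[ℝ] ℝ}
    {u u' : ℝ → E} {G : ℝ → F} (hu : ∀ t ∈ Icc 0 S, HasDerivWithinAt u (u' t) (Icc 0 S) t)
    (hG : ContinuousOn G (Icc 0 S)) (h0 : u 0 = 0) {v : E} {H : F}
    (hweak : ∀ t ∈ Icc 0 S, m (u' t) v + ∫ s in (0 : ℝ)..t, a (G s) H = 0)
    {t : ℝ} (ht : t ∈ Icc 0 S) :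
    m (u t) v + ∫ s in (0 : ℝ)..t, a (∫ r in (0 : ℝ)..s, G r) H = 0 := by
  have h0mem : (0 : ℝ) ∈ Icc 0 S := ⟨le_rfl, ht.1.trans ht.2⟩
  refine eq_zero_of_hasDerivWithinAt_zero
    (Q := fun t => m (u t) v + ∫ s in (0 : ℝ)..t, a (∫ r in (0 : ℝ)..s, G r) H)
    (fun r hr => ?_) (by simp [h0]) ht
  have hΓ : ContinuousOn (fun s => ∫ r in (0 : ℝ)..s, G r) (Icc 0 S) := fun s hs =>
    (hasDerivWithinAt_integral_Icc hG hs).continuousWithinAt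
  -- The time derivative of the claimed equation is the given equation.
  have h1 := ((m.flip v).hasFDerivAt.comp_hasDerivWithinAt r (hu r hr)).add
    (hasDerivWithinAt_integral_Icc ((a.flip H).continuous.comp_continuousOn hΓ) hr)
  refine h1.congr_deriv ?_
  have h2 := hweak r hr
  rw [integral_bilinear_left a (intervalIntegrable_of_continuousOn_Icc hG h0mem hr)] at h2
  exact h2

theorem weak_equation_sub {m : E →L[ℝ] E →L[ℝ] ℝ} {a : F →L[ℝ] F →L[ℝ] ℝ} {p q v : E}
    {G₁ G₂ : ℝ → F} {H : F} (h₁ : ContinuousOn G₁ (Icc 0 S)) (h₂ : ContinuousOn G₂ (Icc 0 S))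
    {t : ℝ} (ht : t ∈ Icc 0 S) (e₁ : m p v + ∫ s in (0 : ℝ)..t, a (G₁ s) H = 0)
    (e₂ : m q v + ∫ s in (0 : ℝ)..t, a (G₂ s) H = 0) :
    m (p - q) v + ∫ s in (0 : ℝ)..t, a (G₁ s - G₂ s) H = 0 := by
  have h0mem : (0 : ℝ) ∈ Icc 0 S := ⟨le_rfl, ht.1.trans ht.2⟩
  have i₁ := intervalIntegrable_of_continuousOn_Icc h₁ h0mem ht
  have i₂ := intervalIntegrable_of_continuousOn_Icc h₂ h0mem ht
  rw [integral_bilinear_left a i₁] at e₁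
  rw [integral_bilinear_left a i₂] at e₂
  rw [integral_bilinear_left a (i₁.sub i₂), intervalIntegral.integral_sub i₁ i₂, map_sub, map_sub,
    sub_apply, sub_apply]
  linarith

end Bilinear

/-! ### Uniqueness of weak gradients -/

theorem HasGradTrace.sub {v₁ v₂ : L2Vec Ω} {G₁ G₂ : L2Mat Ω} {g : Sp d → Sp d}
    (hΩ : IsCompact Ω) (h₁ : HasGradTrace Ω v₁ G₁ g) (h₂ : HasGradTrace Ω v₂ G₂ g) :
    HasGradTrace Ω (v₁ - v₂) (G₁ - G₂) 0 := by
  refine ⟨MemLp.zero, fun ψ hψ i j => ?_⟩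
  obtain ⟨ℓ, k, hℓ⟩ := exists_gradTrace_functional hΩ hψ i j
  have e₁ := h₁.2 ψ hψ i j
  have e₂ := h₂.2 ψ hψ i j
  rw [hℓ] at e₁ e₂ ⊢
  rw [map_sub, map_sub]
  simp only [Pi.zero_apply, PiLp.zero_apply, zero_mul, integral_zero]
  linarith

theorem eq_zero_of_entry_eq_zero {A : Mat d} (h : ∀ i j, entry A i j = 0) : A = 0 := by
  refine ContinuousLinearMap.coe_injective
    ((EuclideanSpace.basisFun (Fin d) ℝ).toBasis.ext fun j => ?_)
  ext i
  simpa [entry] using h i j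

theorem HasGradTrace.grad_unique (hd : 1 ≤ d) (hΩ : IsCompact Ω) (hbd : HasC1Boundary Ω)
    {v : L2Vec Ω} {G₁ G₂ : L2Mat Ω} {g₁ g₂ : Sp d → Sp d}
    (h₁ : HasGradTrace Ω v G₁ g₁) (h₂ : HasGradTrace Ω v G₂ g₂) : G₁ = G₂ := by
  have hfin : IsFiniteMeasure ((volume : Measure (Sp d)).restrict Ω) :=
    ⟨by simpa using hΩ.measure_lt_top⟩
  have hzero : ∀ i j, ∀ᵐ x ∂(volume.restrict Ω), x ∈ interior Ω →
      entry ((G₁ - G₂ : L2Mat Ω) x) i j = 0 := by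
    intro i j
    have hint : Integrable (fun x => entry ((G₁ - G₂ : L2Mat Ω) x) i j) (volume.restrict Ω) :=
      (entryL i j).integrable_comp ((Lp.memLp (G₁ - G₂)).integrable one_le_two)
    refine isOpen_interior.ae_eq_zero_of_integral_contDiff_smul_eq_zero
      (hint.locallyIntegrable.locallyIntegrableOn _) fun ψ hψ _ hsupp => ?_
    obtain ⟨ℓ, k, hℓ⟩ := exists_gradTrace_functional hΩ hψ i j
    have hbdry : ∀ g : Sp d → Sp d, ∫ x, g x i * ψ x * outwardNormal Ω x j ∂(surf Ω) = 0 := by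
      refine fun g => setIntegral_eq_zero_of_forall_eq_zero fun x hx => ?_
      have : ψ x = 0 := by
        by_contra h0
        exact hx.2 (hsupp (subset_tsupport ψ h0))
      rw [this, mul_zero, zero_mul]
    have e₁ := h₁.2 ψ hψ i j
    have e₂ := h₂.2 ψ hψ i j
    rw [hbdry, hℓ] at e₁ e₂
    -- Putting 0 in the displacement slot isolates the gradient part of the functional.
    have e₃ := hℓ 0 (G₁ - G₂)
    rw [map_zero, map_sub] at e₃
    have e₄ : ∫ x in Ω, ψ x • entry ((G₁ - G₂ : L2Mat Ω) x) i j = 0 + (k G₁ - k G₂) := by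
      rw [← e₃]
      refine integral_congr_ae ?_
      filter_upwards [Lp.coeFn_zero (Sp d) 2 (volume.restrict Ω)] with x hx
      rw [hx, Pi.zero_apply, PiLp.zero_apply, zero_mul, zero_add, smul_eq_mul, mul_comm]
    rw [e₄]
    linarith
  have hint : ∀ᵐ x ∂(volume.restrict Ω), x ∈ interior Ω := by
    have h0 : ∀ᵐ x ∂(volume.restrict Ω), x ∉ frontier Ω :=
      ae_restrict_of_ae (measure_eq_zero_iff_ae_notMem.1 (volume_frontier_eq_zero hd hΩ hbd))
    filter_upwards [h0, ae_restrict_mem hΩ.measurableSet] with x hx hxΩ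
    by_contra h
    exact hx ⟨subset_closure hxΩ, h⟩
  rw [← sub_eq_zero]
  refine Lp.ext ?_
  filter_upwards [hint, ae_all_iff.2 fun i => ae_all_iff.2 (hzero i),
    Lp.coeFn_zero (Mat d) 2 (volume.restrict Ω)] with x hx hz h0
  rw [h0]
  exact eq_zero_of_entry_eq_zero fun i j => hz i j hx

/-! ### Uniqueness of weak solutions -/

/-- The energy argument. -/
theorem eq_zero_of_weak_equation (hd : 1 ≤ d) (hΩ : IsCompact Ω) (hmed : IsMedium Ω ρ mu lam)
    {e e' : ℝ → L2Vec Ω} {G : ℝ → L2Mat Ω}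
    (he : ∀ t ∈ Icc 0 S, HasDerivWithinAt e (e' t) (Icc 0 S) t)
    (hG : ContinuousOn G (Icc 0 S)) (h0 : e 0 = 0)
    (hweak : ∀ t ∈ Icc 0 S, massForm Ω ρ (e' t) (e t)
      + ∫ s in (0 : ℝ)..t, elasticForm Ω mu lam (G s) (G t) = 0)
    {t : ℝ} (ht : t ∈ Icc 0 S) : e t = 0 := by
  obtain ⟨m, hm⟩ := exists_massForm_eq hΩ hmed
  obtain ⟨a, ha⟩ := exists_elasticForm_eq hΩ hmed
  simp only [hm, ha] at hweak
  have hQ := energy_eq_zero (fun u v => by rw [← hm, ← hm, massForm_comm])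
    (fun G H => by rw [← ha, ← ha, elasticForm_comm]) he hG h0 hweak ht
  have hnn := elasticForm_self_nonneg hd hΩ hmed (∫ s in (0 : ℝ)..t, G s)
  refine eq_zero_of_massForm_self_nonpos hΩ hmed ?_
  rw [hm]
  rw [ha] at hnn
  linarith

/-- Two solutions with the same data differ by a curve of zero trace, so at each time the difference
may itself serve as test function. -/
theorem IsWeakSolution.unique (hd : 1 ≤ d) (hΩ : IsCompact Ω) (hmed : IsMedium Ω ρ mu lam)
    {f : ℝ → Sp d → Sp d} {u₁ u₂ : ℝ → L2Vec Ω} (h₁ : IsWeakSolution Ω ρ mu lam S f u₁)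
    (h₂ : IsWeakSolution Ω ρ mu lam S f u₂) {t : ℝ} (ht : t ∈ Icc 0 S) : u₁ t = u₂ t := by
  obtain ⟨u₁', G₁, hc₁, h₁0, -, htr₁, hw₁⟩ := h₁
  obtain ⟨u₂', G₂, hc₂, h₂0, -, htr₂, hw₂⟩ := h₂
  obtain ⟨m, hm⟩ := exists_massForm_eq hΩ hmed
  obtain ⟨a, ha⟩ := exists_elasticForm_eq hΩ hmed
  rw [← sub_eq_zero]
  refine eq_zero_of_weak_equation (e := fun r => u₁ r - u₂ r) (e' := fun r => u₁' r - u₂' r)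
    (G := fun r => G₁ r - G₂ r) hd hΩ hmed (fun r hr => (hc₁.hasDeriv r hr).sub (hc₂.hasDeriv r hr))
    (hc₁.cont_grad.sub hc₂.cont_grad) (by simp [h₁0, h₂0]) (fun r hr => ?_) ht
  have htr := (htr₁ r hr).sub hΩ (htr₂ r hr)
  have e₁ := hw₁ r hr _ _ htr
  have e₂ := hw₂ r hr _ _ htr
  simp only [hm, ha] at e₁ e₂ ⊢
  exact weak_equation_sub hc₁.cont_grad hc₂.cont_grad hr e₁ e₂

/-! ### Functions on the lateral boundary -/

theorem ae_surf_mem_frontier : ∀ᵐ x ∂(surf Ω), x ∈ frontier Ω :=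
  ae_restrict_mem isClosed_frontier.measurableSet

theorem HasGradTrace.congr {v : L2Vec Ω} {G : L2Mat Ω} {g g' : Sp d → Sp d}
    (h : HasGradTrace Ω v G g) (hg : ∀ x ∈ frontier Ω, g x = g' x) : HasGradTrace Ω v G g' := by
  have hae : g =ᵐ[surf Ω] g' := by
    filter_upwards [ae_surf_mem_frontier] with x hx using hg x hx
  refine ⟨h.1.ae_eq hae, fun ψ hψ i j => (h.2 ψ hψ i j).trans (integral_congr_ae ?_)⟩
  filter_upwards [hae] with x hx
  rw [hx]

theorem restrict_prod_surf [IsFiniteMeasure (surf Ω)] (s : Set ℝ) :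
    ((volume : Measure ℝ).restrict s).prod (surf Ω) =
      (volume.prod (surf Ω)).restrict (s ×ˢ frontier Ω) := by
  rw [← Measure.prod_restrict, surf, Measure.restrict_restrict isClosed_frontier.measurableSet,
    inter_self]

theorem memLp_prod_surf_of_continuousOn [IsFiniteMeasure (surf Ω)] (hΩ : IsCompact Ω)
    {E : Type*} [NormedAddCommGroup E] {q : ℝ × Sp d → E}
    (hq : ContinuousOn q (Icc 0 S ×ˢ frontier Ω)) {s : Set ℝ} (hs : MeasurableSet s)
    (hsS : s ⊆ Icc 0 S) (p : ENNReal) : MemLp q p ((volume.restrict s).prod (surf Ω)) := by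
  have hfin : IsFiniteMeasure ((volume : Measure ℝ).restrict s) :=
    ⟨by simpa using (measure_mono hsS).trans_lt isCompact_Icc.measure_lt_top⟩
  have hK : IsCompact (Icc 0 S ×ˢ frontier Ω) := isCompact_Icc.prod (isCompact_frontier hΩ)
  have hsub : s ×ˢ frontier Ω ⊆ Icc 0 S ×ˢ frontier Ω := prod_mono hsS Subset.rfl
  have hmeas : MeasurableSet (s ×ˢ frontier Ω) := hs.prod isClosed_frontier.measurableSet
  obtain ⟨C, hC⟩ := hK.exists_bound_of_continuousOn hq
  refine MemLp.of_bound ?_ C ?_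
  · rw [restrict_prod_surf]
    refine AEStronglyMeasurable.mono_measure ?_ (Measure.restrict_mono hsub le_rfl)
    exact hq.aestronglyMeasurable_of_isCompact hK hK.measurableSet
  · rw [restrict_prod_surf]
    exact (ae_restrict_iff' hmeas).2 (.of_forall fun z hz => hC z (hsub hz))

theorem memL2Bdry_of_continuousOn [IsFiniteMeasure (surf Ω)] (hΩ : IsCompact Ω)
    {g : ℝ → Sp d → Sp d} (hg : ContinuousOn (Function.uncurry g) (Icc 0 S ×ˢ frontier Ω)) :
    MemL2Bdry Ω S g :=
  memLp_prod_surf_of_continuousOn hΩ hg measurableSet_Ioo Ioo_subset_Icc_self 2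

theorem MemL2Bdry.integrable_inner {f g : ℝ → Sp d → Sp d}
    (hf : MemL2Bdry Ω S f) (hg : MemL2Bdry Ω S g) :
    Integrable (fun z : ℝ × Sp d => inner ℝ (f z.1 z.2) (g z.1 z.2))
      ((volume.restrict (Ioo 0 S)).prod (surf Ω)) :=
  memLp_one_iff_integrable.1 (innerL.memLp_of_bilin 1 hf hg)

theorem MemL2Bdry.mono {f : ℝ → Sp d → Sp d} [IsFiniteMeasure (surf Ω)]
    (hf : MemL2Bdry Ω S f) (hT : T ≤ S) : MemL2Bdry Ω T f := by
  refine MemLp.mono_measure ?_ hf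
  rw [restrict_prod_surf, restrict_prod_surf]
  exact Measure.restrict_mono (prod_mono (Ioo_subset_Ioo_right hT) Subset.rfl) le_rfl

theorem MemL2Bdry.comp_sub {f : ℝ → Sp d → Sp d} [IsFiniteMeasure (surf Ω)]
    (hf : MemL2Bdry Ω S f) : MemL2Bdry Ω S fun t => f (S - t) := by
  have h1 : MeasurePreserving (fun t : ℝ => S - t) (volume.restrict (Ioo 0 S))
      (volume.restrict (Ioo 0 S)) := by
    have := (⟨by fun_prop, Measure.map_sub_left_eq_self volume S⟩ : MeasurePreserving
      (fun t : ℝ => S - t) volume volume).restrict_preimage (s := Ioo 0 S) measurableSet_Ioo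
    simpa using this
  exact MemLp.comp_measurePreserving hf (h1.prod (MeasurePreserving.id (surf Ω)))

theorem intervalIntegrable_of_integrable_Ioo {q : ℝ → ℝ}
    (hq : IntegrableOn q (Ioo 0 S) volume) {s t : ℝ} (hs : s ∈ Icc 0 S) (ht : t ∈ Icc 0 S) :
    IntervalIntegrable q volume s t := by
  have hS : 0 ≤ S := hs.1.trans hs.2
  have h : IntervalIntegrable q volume 0 S :=
    (intervalIntegrable_iff_integrableOn_Ioo_of_le hS).2 hq
  exact h.mono_set (uIcc_subset_uIcc (by rwa [uIcc_of_le hS]) (by rwa [uIcc_of_le hS]))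

theorem bdryInner_eq_integral_prod [IsFiniteMeasure (surf Ω)] (hS : 0 ≤ S)
    {f g : ℝ → Sp d → Sp d} (hf : MemL2Bdry Ω S f) (hg : MemL2Bdry Ω S g) :
    bdryInner Ω S f g = ∫ z : ℝ × Sp d, inner ℝ (f z.1 z.2) (g z.1 z.2)
      ∂((volume.restrict (Ioo 0 S)).prod (surf Ω)) := by
  rw [bdryInner, intervalIntegral.integral_of_le hS, integral_Ioc_eq_integral_Ioo,
    integral_prod _ (hf.integrable_inner hg)]

theorem bdryInner_congr {f f' g g' : ℝ → Sp d → Sp d} (hS : 0 ≤ S)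
    (hf : ∀ t ∈ Icc 0 S, ∀ x ∈ frontier Ω, f t x = f' t x)
    (hg : ∀ t ∈ Icc 0 S, ∀ x ∈ frontier Ω, g t x = g' t x) :
    bdryInner Ω S f g = bdryInner Ω S f' g' := by
  refine intervalIntegral.integral_congr fun t ht => integral_congr_ae ?_
  rw [uIcc_of_le hS] at ht
  filter_upwards [ae_surf_mem_frontier] with x hx
  rw [hf t ht x hx, hg t ht x hx]

theorem bdryInner_sub_right [IsFiniteMeasure (surf Ω)] (hS : 0 ≤ S)
    {f g g' : ℝ → Sp d → Sp d} (hf : MemL2Bdry Ω S f) (hg : MemL2Bdry Ω S g)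
    (hg' : MemL2Bdry Ω S g') :
    bdryInner Ω S f (g - g') = bdryInner Ω S f g - bdryInner Ω S f g' := by
  have hsub : MemL2Bdry Ω S (g - g') := MemLp.sub hg hg'
  rw [bdryInner_eq_integral_prod hS hf hsub, bdryInner_eq_integral_prod hS hf hg,
    bdryInner_eq_integral_prod hS hf hg',
    ← integral_sub (hf.integrable_inner hg) (hf.integrable_inner hg')]
  simp only [Pi.sub_apply, inner_sub_right]

theorem bdryInner_smul_right (c : ℝ) (f g : ℝ → Sp d → Sp d) :
    bdryInner Ω S f (c • g) = c * bdryInner Ω S f g := by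
  simp only [bdryInner, Pi.smul_apply, inner_smul_right, integral_const_mul,
    intervalIntegral.integral_const_mul]

/-! ### Time primitives of boundary data -/

theorem continuousOn_slice {g : ℝ → Sp d → Sp d}
    (hg : ContinuousOn (Function.uncurry g) (Icc 0 S ×ˢ frontier Ω)) {x : Sp d}
    (hx : x ∈ frontier Ω) : ContinuousOn (fun t => g t x) (Icc 0 S) :=
  hg.comp (f := fun t : ℝ => (t, x)) (by fun_prop) fun _ ht => ⟨ht, hx⟩

/-- The interior side of the trace identity is a continuous linear functional of (u, G) and commutes
with the time integral; the boundary side is handled by Fubini, where continuity of the data and of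
the normal gives integrability. -/
theorem HasGradTrace.primitive [IsFiniteMeasure (surf Ω)] (hΩ : IsCompact Ω)
    (hbd : HasC1Boundary Ω) {u : ℝ → L2Vec Ω} {G : ℝ → L2Mat Ω} {g : ℝ → Sp d → Sp d}
    (hu : ContinuousOn u (Icc 0 S)) (hG : ContinuousOn G (Icc 0 S))
    (hg : ContinuousOn (Function.uncurry g) (Icc 0 S ×ˢ frontier Ω))
    (htr : ∀ t ∈ Icc 0 S, HasGradTrace Ω (u t) (G t) (g t)) {t : ℝ} (ht : t ∈ Icc 0 S)
    (hmem : MemLp (fun x => ∫ s in (0 : ℝ)..t, g s x) 2 (surf Ω)) :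
    HasGradTrace Ω (∫ s in (0 : ℝ)..t, u s) (∫ s in (0 : ℝ)..t, G s)
      (fun x => ∫ s in (0 : ℝ)..t, g s x) := by
  have h0mem : (0 : ℝ) ∈ Icc 0 S := ⟨le_rfl, ht.1.trans ht.2⟩
  refine ⟨hmem, fun ψ hψ i j => ?_⟩
  obtain ⟨ℓ, k, hℓ⟩ := exists_gradTrace_functional hΩ hψ i j
  have iu := intervalIntegrable_of_continuousOn_Icc hu h0mem ht
  have iG := intervalIntegrable_of_continuousOn_Icc hG h0mem ht
  have iu' := intervalIntegrable_of_continuousOn_Icc (ℓ.continuous.comp_continuousOn hu) h0mem ht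
  have iG' := intervalIntegrable_of_continuousOn_Icc (k.continuous.comp_continuousOn hG) h0mem ht
  rw [hℓ, ← ℓ.intervalIntegral_comp_comm iu, ← k.intervalIntegral_comp_comm iG,
    ← intervalIntegral.integral_add (f := fun s => ℓ (u s)) (g := fun s => k (G s)) iu' iG']
  have h1 : ∫ s in (0 : ℝ)..t, (ℓ (u s) + k (G s)) =
      ∫ s in (0 : ℝ)..t, ∫ x, g s x i * ψ x * outwardNormal Ω x j ∂(surf Ω) := by
    refine intervalIntegral.integral_congr fun s hs => ?_
    rw [uIcc_of_le ht.1] at hs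
    rw [← hℓ, (htr s ⟨hs.1, hs.2.trans ht.2⟩).2 ψ hψ i j]
  refine h1.trans ?_
  rw [intervalIntegral_integral_swap]
  · refine integral_congr_ae ?_
    filter_upwards [ae_surf_mem_frontier] with x hx
    have h2 := (EuclideanSpace.proj (𝕜 := ℝ) i).intervalIntegral_comp_comm
      (intervalIntegrable_of_continuousOn_Icc (continuousOn_slice hg hx) h0mem ht)
    simp only [EuclideanSpace.coe_proj] at h2
    rw [intervalIntegral.integral_mul_const, intervalIntegral.integral_mul_const, h2]
  · rw [uIoc_of_le ht.1]
    refine memLp_one_iff_integrable.1 (memLp_prod_surf_of_continuousOn (S := S) hΩ ?_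
      measurableSet_Ioc (Ioc_subset_Icc_self.trans (Icc_subset_Icc_right ht.2)) 1)
    have hν : ContinuousOn (fun z : ℝ × Sp d => outwardNormal Ω z.2) (Icc 0 S ×ˢ frontier Ω) :=
      (continuousOn_outwardNormal hΩ.isClosed hbd).comp continuousOn_snd fun z hz => hz.2
    have h2 := (EuclideanSpace.proj (𝕜 := ℝ) i).continuous.comp_continuousOn hg
    have h3 := (EuclideanSpace.proj (𝕜 := ℝ) j).continuous.comp_continuousOn hν
    exact (h2.mul (hψ.continuous.comp continuous_snd).continuousOn).mul h3

theorem timePrimitive_extendZero {f : ℝ → Sp d → Sp d} {x : Sp d} {t : ℝ} (h0 : 0 ≤ t)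
    (hT : 0 ≤ T) :
    timePrimitive (extendZero T f) t x = ∫ s in (0 : ℝ)..min t T, f s x := by
  have h1 : (fun s => extendZero T f s x) = (Ioo 0 T).indicator fun s => f s x := by
    ext1 s
    simp only [extendZero, indicator]
  rw [timePrimitive, h1, intervalIntegral.integral_of_le h0,
    intervalIntegral.integral_of_le (le_min h0 hT), setIntegral_indicator measurableSet_Ioo]
  refine setIntegral_congr_set ?_
  have h2 : Ioc 0 (min t T) = Ioc 0 t ∩ Ioc 0 T := by
    rw [Ioc_inter_Ioc, max_self]
  rw [h2]
  exact (ae_eq_refl _).inter Ioo_ae_eq_Ioc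

theorem IsSource.continuousOn {f : ℝ → Sp d → Sp d} (hf : IsSource Ω T f) :
    ContinuousOn (Function.uncurry f) (Icc 0 T ×ˢ frontier Ω) := by
  obtain ⟨⟨F, hF, hfF⟩, -⟩ := hf
  exact hF.continuous.continuousOn.congr fun z hz => hfF z.1 hz.1 z.2 hz.2

/-- The zero extension may jump at T, but its primitive merely stops changing there. This continuity
is what Green's formula requires of the data of `w`. -/
theorem IsSource.continuousOn_timePrimitive {f : ℝ → Sp d → Sp d} (hf : IsSource Ω T f)
    (hT : 0 ≤ T) : ContinuousOn (Function.uncurry (timePrimitive (extendZero T f)))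
      (Icc 0 S ×ˢ frontier Ω) := by
  obtain ⟨⟨F, hF, hfF⟩, -⟩ := hf
  have hc : Continuous fun z : ℝ × Sp d => ∫ s in (0 : ℝ)..min z.1 T, F (s, z.2) :=
    intervalIntegral.continuous_parametric_intervalIntegral_of_continuous
      (f := fun (z : ℝ × Sp d) s => F (s, z.2))
      (hF.continuous.comp (by fun_prop)) (by fun_prop)
  refine hc.continuousOn.congr fun z hz => ?_
  rw [Function.uncurry, timePrimitive_extendZero hz.1.1 hT]
  refine intervalIntegral.integral_congr fun s hs => ?_
  rw [uIcc_of_le (le_min hz.1.1 hT)] at hs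
  exact hfF s ⟨hs.1, hs.2.trans (min_le_right _ _)⟩ z.2 hz.2

theorem IsSource.intervalIntegrable_extendZero {f : ℝ → Sp d → Sp d} (hf : IsSource Ω T f)
    {x : Sp d} (hx : x ∈ frontier Ω) (a b : ℝ) :
    IntervalIntegrable (fun s => extendZero T f s x) volume a b := by
  have h1 : (fun s => extendZero T f s x) = (Ioo 0 T).indicator fun s => f s x := by
    ext1 s
    simp only [extendZero, indicator]
  rw [h1]
  have h2 : IntegrableOn (fun s => f s x) (Ioo 0 T) :=
    ((continuousOn_slice hf.continuousOn hx).integrableOn_Icc).mono_set Ioo_subset_Icc_self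
  exact (h2.integrable_indicator measurableSet_Ioo).intervalIntegrable

/-- The weak solution whose data are the time primitive of `f` is the primitive of the solution
with data `f`. -/
theorem IsWeakSolution.primitive_hasDerivWithinAt (hd : 1 ≤ d) (hΩ : IsCompact Ω)
    (hbd : HasC1Boundary Ω) (hmed : IsMedium Ω ρ mu lam) {f g : ℝ → Sp d → Sp d}
    {u w : ℝ → L2Vec Ω} (hST : S ≤ T)
    (hf : ContinuousOn (Function.uncurry f) (Icc 0 S ×ˢ frontier Ω))
    (hfg : ∀ t ∈ Icc 0 S, ∀ x ∈ frontier Ω, g t x = ∫ s in (0 : ℝ)..t, f s x)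
    (hu : IsWeakSolution Ω ρ mu lam S f u) (hw : IsWeakSolution Ω ρ mu lam T g w)
    {t : ℝ} (ht : t ∈ Icc 0 S) : HasDerivWithinAt w (u t) (Icc 0 S) t := by
  have hsurf := isFiniteMeasure_surf hd hΩ hbd
  obtain ⟨m, hm⟩ := exists_massForm_eq hΩ hmed
  obtain ⟨a, ha⟩ := exists_elasticForm_eq hΩ hmed
  obtain ⟨u', Gu, hcu, hu0, -, htru, hwu⟩ := hu
  obtain ⟨w', Gw, hcw, hw0, -, htrw, hww⟩ := hw
  have hsub : Icc 0 S ⊆ Icc 0 T := Icc_subset_Icc_right hST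
  have hucont : ContinuousOn u (Icc 0 S) := fun r hr => (hcu.hasDeriv r hr).continuousWithinAt
  have hGcont : ContinuousOn (fun r => ∫ s in (0 : ℝ)..r, Gu s) (Icc 0 S) := fun r hr =>
    (hasDerivWithinAt_integral_Icc hcu.cont_grad hr).continuousWithinAt
  have hGw : ContinuousOn Gw (Icc 0 S) := hcw.cont_grad.mono hsub
  have heq : ∀ r ∈ Icc 0 S, w r = ∫ s in (0 : ℝ)..r, u s := by
    intro r hr
    rw [← sub_eq_zero]
    refine eq_zero_of_weak_equation (e := fun r => w r - ∫ s in (0 : ℝ)..r, u s)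
      (e' := fun r => w' r - u r) (G := fun r => Gw r - ∫ s in (0 : ℝ)..r, Gu s) hd hΩ hmed
      (fun r hr => ((hcw.hasDeriv r (hsub hr)).mono hsub).sub
        (hasDerivWithinAt_integral_Icc hucont hr))
      (hGw.sub hGcont) (by simp [hw0]) (fun r hr => ?_) hr
    have h1 := (htrw r (hsub hr)).congr (hfg r hr)
    -- Both curves have the same trace at time `r`, so their difference is an admissible test
    -- function.
    have htr := h1.sub hΩ
      (HasGradTrace.primitive hΩ hbd hucont hcu.cont_grad hf htru hr h1.1)
    have e₁ := hww r (hsub hr) _ _ htr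
    have e₂ := fun q hq => hwu q hq _ _ htr
    simp only [hm, ha] at e₁ e₂ ⊢
    exact weak_equation_sub hGw hGcont hr e₁
      (weak_equation_primitive hcu.hasDeriv hcu.cont_grad hu0 e₂ hr)
  exact (hasDerivWithinAt_integral_Icc hucont ht).congr heq (heq t ht)

/-! ### An integration by parts formula -/

/-- On a partition of mesh below δ the local errors add up to at most ε∫c, and ε is arbitrary. No
differentiability of `F` enters. -/
theorem sub_eq_integral_of_oscillation {F k c : ℝ → ℝ} {S : ℝ} (hS : 0 ≤ S)
    (hk : IntervalIntegrable k volume 0 S) (hc : IntervalIntegrable c volume 0 S)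
    (h : ∀ ε > 0, ∃ δ > 0, ∀ s ∈ Icc 0 S, ∀ t ∈ Icc 0 S, s ≤ t → t - s < δ →
      |F t - F s - ∫ r in s..t, k r| ≤ ε * ∫ r in s..t, c r) :
    F S - F 0 = ∫ r in (0 : ℝ)..S, k r := by
  have key : ∀ ε > 0, |F S - F 0 - ∫ r in (0 : ℝ)..S, k r| ≤ ε * ∫ r in (0 : ℝ)..S, c r := by
    intro ε hε
    obtain ⟨δ, hδ, hosc⟩ := h ε hε
    obtain ⟨n, hn⟩ := exists_nat_gt (S / δ)
    have hn0 : (0 : ℝ) < n := (div_nonneg hS hδ.le).trans_lt hn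
    set p : ℕ → ℝ := fun i => i * (S / n) with hp
    have hp0 : p 0 = 0 := by simp [hp]
    have hpn : p n = S := by simp only [hp]; field_simp
    have hstep : 0 ≤ S / n := by positivity
    have hmem : ∀ i ≤ n, p i ∈ Icc 0 S := fun i hi => by
      refine ⟨by positivity, ?_⟩
      rw [← hpn]
      simp only [hp]
      gcongr
    have hsub : ∀ i ≤ n, ∀ j ≤ n, uIcc (p i) (p j) ⊆ uIcc 0 S := fun i hi j hj => by
      rw [uIcc_of_le hS]
      exact uIcc_subset_Icc (hmem i hi) (hmem j hj)
    have hsk := intervalIntegral.sum_integral_adjacent_intervals (f := k) (μ := volume) (a := p)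
      (n := n) fun i hi => hk.mono_set (hsub i hi.le (i + 1) hi)
    have hsc := intervalIntegral.sum_integral_adjacent_intervals (f := c) (μ := volume) (a := p)
      (n := n) fun i hi => hc.mono_set (hsub i hi.le (i + 1) hi)
    have hsF := Finset.sum_range_sub (fun i => F (p i)) n
    rw [hp0, hpn] at hsk hsc hsF
    rw [← hsk, ← hsc, ← hsF, ← Finset.sum_sub_distrib, Finset.mul_sum]
    refine (Finset.abs_sum_le_sum_abs _ _).trans (Finset.sum_le_sum fun i hi => ?_)
    have hi' : i + 1 ≤ n := Finset.mem_range.1 hi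
    have hdiff : p (i + 1) - p i = S / n := by
      simp only [hp]
      push_cast
      ring
    refine hosc _ (hmem i (by omega)) _ (hmem _ hi') (by linarith) ?_
    rw [hdiff, div_lt_iff₀ hn0]
    rwa [div_lt_iff₀ hδ, mul_comm] at hn
  have hlim : Tendsto (fun ε : ℝ => ε * ∫ r in (0 : ℝ)..S, c r) (𝓝[>] 0) (𝓝 0) := by
    have : Continuous fun ε : ℝ => ε * ∫ r in (0 : ℝ)..S, c r := by fun_prop
    simpa using (this.tendsto 0).mono_left nhdsWithin_le_nhds
  have h0 := ge_of_tendsto hlim (eventually_nhdsWithin_of_forall fun ε hε => key ε hε)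
  exact sub_eq_zero.1 (abs_nonpos_iff.1 h0)

theorem sub_eq_integral_of_hasDerivWithinAt_Icc {E : Type*} [NormedAddCommGroup E]
    [NormedSpace ℝ E] [CompleteSpace E] {z z' : ℝ → E} {S s t : ℝ}
    (hz : ∀ t ∈ Icc 0 S, HasDerivWithinAt z (z' t) (Icc 0 S) t)
    (hz' : ContinuousOn z' (Icc 0 S)) (hs : s ∈ Icc 0 S) (ht : t ∈ Icc 0 S) (hst : s ≤ t) :
    z t - z s = ∫ r in s..t, z' r := by
  refine (intervalIntegral.integral_eq_sub_of_hasDerivAt_of_le hst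
    (fun r hr => ((hz r ⟨hs.1.trans hr.1, hr.2.trans ht.2⟩).continuousWithinAt).mono
      (Icc_subset_Icc hs.1 ht.2)) (fun r hr => ?_)
    (intervalIntegrable_of_continuousOn_Icc hz' hs ht)).symm
  have h1 : 0 < r := hs.1.trans_lt hr.1
  have h2 : r < S := hr.2.trans_le ht.2
  exact (hz r ⟨h1.le, h2.le⟩).hasDerivAt (Icc_mem_nhds h1 h2)

section Bilinear

variable {E F : Type*} [NormedAddCommGroup E] [NormedSpace ℝ E] [CompleteSpace E]
  [NormedAddCommGroup F] [NormedSpace ℝ F]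

theorem exists_uniform_dist_lt {X Y : Type*} [PseudoMetricSpace X] [PseudoMetricSpace Y]
    {g : X → Y} {K : Set X} (hK : IsCompact K) (hg : ContinuousOn g K) {ε : ℝ} (hε : 0 < ε) :
    ∃ δ > 0, ∀ s ∈ K, ∀ t ∈ K, dist s t < δ → dist (g s) (g t) < ε :=
  Metric.uniformContinuousOn_iff.1 (hK.uniformContinuousOn_of_continuous hg) ε hε

/-- The product rule for `m(y', z)`, where the weak derivative of `y'` is `-a(G, ·) + b(t, ·)`. -/
theorem bilinear_integration_by_parts (m : E →L[ℝ] E →L[ℝ] ℝ) (a : F →L[ℝ] F →L[ℝ] ℝ)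
    {y' z z' : ℝ → E} {G H : ℝ → F} {b : ℝ → ℝ → ℝ} {c : ℝ → ℝ} (hS : 0 ≤ S)
    (hy' : ContinuousOn y' (Icc 0 S)) (hG : ContinuousOn G (Icc 0 S))
    (hz : ∀ t ∈ Icc 0 S, HasDerivWithinAt z (z' t) (Icc 0 S) t)
    (hz' : ContinuousOn z' (Icc 0 S)) (hH : ContinuousOn H (Icc 0 S))
    (hb : ∀ t ∈ Icc 0 S, IntegrableOn (fun r => b r t) (Ioo 0 S))
    (hbb : IntegrableOn (fun r => b r r) (Ioo 0 S)) (hc : IntegrableOn c (Ioo 0 S))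
    (hosc : ∀ ε > 0, ∃ δ > 0, ∀ᵐ r ∂(volume.restrict (Ioo 0 S)), ∀ t ∈ Icc 0 S, |r - t| < δ →
      |b r t - b r r| ≤ ε * c r)
    (hweak : ∀ s ∈ Icc 0 S, ∀ t ∈ Icc 0 S, s ≤ t →
      m (y' t) (z t) - m (y' s) (z t) + ∫ r in s..t, a (G r) (H t) = ∫ r in s..t, b r t) :
    m (y' S) (z S) - m (y' 0) (z 0) =
      ∫ r in (0 : ℝ)..S, (m (y' r) (z' r) - a (G r) (H r) + b r r) := by
  have h0mem : (0 : ℝ) ∈ Icc 0 S := ⟨le_rfl, hS⟩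
  have hSmem : S ∈ Icc 0 S := ⟨hS, le_rfl⟩
  obtain ⟨A, hA⟩ := isCompact_Icc.exists_bound_of_continuousOn hG
  obtain ⟨B, hB⟩ := isCompact_Icc.exists_bound_of_continuousOn hz'
  have hA0 : 0 ≤ A := (norm_nonneg _).trans (hA 0 h0mem)
  have hB0 : 0 ≤ B := (norm_nonneg _).trans (hB 0 h0mem)
  have cm : ContinuousOn (fun r => m (y' r) (z' r)) (Icc 0 S) :=
    (m.continuous.comp_continuousOn hy').clm_apply hz'
  have ca : ContinuousOn (fun r => a (G r) (H r)) (Icc 0 S) :=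
    (a.continuous.comp_continuousOn hG).clm_apply hH
  have hint : ∀ s ∈ Icc 0 S, ∀ t ∈ Icc 0 S, IntervalIntegrable
      (fun r => m (y' r) (z' r) - a (G r) (H r) + b r r) volume s t := fun s hs t ht =>
    (intervalIntegrable_of_continuousOn_Icc (cm.sub ca) hs ht).add
      (intervalIntegrable_of_integrable_Ioo hbb hs ht)
  have hcint : ∀ s ∈ Icc 0 S, ∀ t ∈ Icc 0 S, IntervalIntegrable
      (fun r => ‖m‖ * B + ‖a‖ * A + c r) volume s t := fun s hs t ht =>
    intervalIntegrable_const.add (intervalIntegrable_of_integrable_Ioo hc hs ht)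
  refine sub_eq_integral_of_oscillation (F := fun t => m (y' t) (z t)) hS (hint 0 h0mem S hSmem)
    (hcint 0 h0mem S hSmem) fun ε hε => ?_
  obtain ⟨δ₁, hδ₁, h₁⟩ := exists_uniform_dist_lt isCompact_Icc hy' hε
  obtain ⟨δ₂, hδ₂, h₂⟩ := exists_uniform_dist_lt isCompact_Icc hH hε
  obtain ⟨δ₃, hδ₃, h₃⟩ := hosc ε hε
  refine ⟨min δ₁ (min δ₂ δ₃), by positivity, fun s hs t ht hst hlt => ?_⟩
  have im : IntervalIntegrable (fun r => m (y' s) (z' r)) volume s t :=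
    intervalIntegrable_of_continuousOn_Icc ((m (y' s)).continuous.comp_continuousOn hz') hs ht
  have ia : IntervalIntegrable (fun r => a (G r) (H t)) volume s t :=
    intervalIntegrable_of_continuousOn_Icc ((a.flip (H t)).continuous.comp_continuousOn hG) hs ht
  have ib := intervalIntegrable_of_integrable_Ioo (hb t ht) hs ht
  -- The increment of m(y', z) splits in two: the change of y' against the frozen z(t) is the weak
  -- equation, and the change of z against the frozen y'(s) is the fundamental theorem.
  have e1 : m (y' s) (z t) - m (y' s) (z s) = ∫ r in s..t, m (y' s) (z' r) := by
    rw [(m (y' s)).intervalIntegral_comp_comm (intervalIntegrable_of_continuousOn_Icc hz' hs ht),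
      ← sub_eq_integral_of_hasDerivWithinAt_Icc hz hz' hs ht hst, map_sub]
  have e2 : m (y' t) (z t) - m (y' s) (z s) -
      ∫ r in s..t, (m (y' r) (z' r) - a (G r) (H r) + b r r) =
      ∫ r in s..t, ((b r t - a (G r) (H t) + m (y' s) (z' r)) -
        (m (y' r) (z' r) - a (G r) (H r) + b r r)) := by
    rw [intervalIntegral.integral_sub ((ib.sub ia).add im) (hint s hs t ht),
      intervalIntegral.integral_add (ib.sub ia) im, intervalIntegral.integral_sub ib ia, ← e1,
      ← hweak s hs t ht hst]
    ring
  rw [e2, ← intervalIntegral.integral_const_mul, ← Real.norm_eq_abs]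
  refine intervalIntegral.norm_integral_le_of_norm_le hst ?_ ((hcint s hs t ht).const_mul ε)
  have hIoo : ∀ᵐ r, r ∈ Ioo 0 S → ∀ t ∈ Icc 0 S, |r - t| < δ₃ → |b r t - b r r| ≤ ε * c r :=
    (ae_restrict_iff' measurableSet_Ioo).1 h₃
  -- Interval integrals run over a half-open interval, while `hosc` speaks only of the open one.
  have hne : ∀ᵐ r : ℝ, r ≠ S := by simp [ae_iff]
  filter_upwards [hIoo, hne] with r hr hrS hrst
  have hrmem : r ∈ Icc 0 S := ⟨hs.1.trans hrst.1.le, hrst.2.trans ht.2⟩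
  have d1 : dist s r < δ₁ := by
    rw [dist_comm, Real.dist_eq, abs_of_pos (by linarith [hrst.1])]
    linarith [hrst.2, min_le_left δ₁ (min δ₂ δ₃)]
  have d0 : |r - t| < min δ₂ δ₃ := by
    rw [abs_sub_comm, abs_of_nonneg (by linarith [hrst.2])]
    linarith [hrst.1, min_le_right δ₁ (min δ₂ δ₃)]
  have d2 : dist r t < δ₂ := d0.trans_le (min_le_left _ _)
  have d3 : |r - t| < δ₃ := d0.trans_le (min_le_right _ _)
  have b1 : |m (y' s - y' r) (z' r)| ≤ ε * (‖m‖ * B) := by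
    calc |m (y' s - y' r) (z' r)| ≤ ‖m‖ * ‖y' s - y' r‖ * ‖z' r‖ := m.le_opNorm₂ _ _
      _ ≤ ‖m‖ * ε * B := by
        have := (h₁ s hs r hrmem d1).le
        rw [dist_eq_norm] at this
        gcongr
        exact hB r hrmem
      _ = ε * (‖m‖ * B) := by ring
  have b2 : |a (G r) (H r - H t)| ≤ ε * (‖a‖ * A) := by
    calc |a (G r) (H r - H t)| ≤ ‖a‖ * ‖G r‖ * ‖H r - H t‖ := a.le_opNorm₂ _ _
      _ ≤ ‖a‖ * A * ε := by
        have := (h₂ r hrmem t ht d2).le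
        rw [dist_eq_norm] at this
        gcongr
        exact hA r hrmem
      _ = ε * (‖a‖ * A) := by ring
  have b3 := hr ⟨hs.1.trans_lt hrst.1, lt_of_le_of_ne hrmem.2 hrS⟩ t ht d3
  have e3 : (b r t - a (G r) (H t) + m (y' s) (z' r)) -
      (m (y' r) (z' r) - a (G r) (H r) + b r r) =
      m (y' s - y' r) (z' r) + a (G r) (H r - H t) + (b r t - b r r) := by
    rw [map_sub, map_sub, sub_apply]
    ring
  rw [e3, Real.norm_eq_abs]
  calc _ ≤ |m (y' s - y' r) (z' r)| + |a (G r) (H r - H t)| + |b r t - b r r| := abs_add_three _ _ _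
    _ ≤ ε * (‖m‖ * B) + ε * (‖a‖ * A) + ε * c r := by gcongr
    _ = _ := by ring

end Bilinear

/-! ### Green's formula for weak solutions -/

/-- An energy curve `u` with velocity `u'`, gradient `G`, boundary trace `g` that is continuous in
space-time, and surface traction `τ`, so that Green's formula holds on all time intervals. -/
structure GreenCurve (Ω : Set (Sp d)) (ρ mu lam : Sp d → ℝ) (S : ℝ) (u u' : ℝ → L2Vec Ω)
    (G : ℝ → L2Mat Ω) (g τ : ℝ → Sp d → Sp d) : Prop where
  hasDeriv : ∀ t ∈ Icc 0 S, HasDerivWithinAt u (u' t) (Icc 0 S) t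
  cont_deriv : ContinuousOn u' (Icc 0 S)
  cont_grad : ContinuousOn G (Icc 0 S)
  trace : ∀ t ∈ Icc 0 S, HasGradTrace Ω (u t) (G t) (g t)
  cont_trace : ContinuousOn (Function.uncurry g) (Icc 0 S ×ˢ frontier Ω)
  memL2_traction : MemL2Bdry Ω S τ
  green : ∀ s ∈ Icc 0 S, ∀ t ∈ Icc 0 S, s ≤ t → ∀ (v : L2Vec Ω) (Gv : L2Mat Ω) (k : Sp d → Sp d),
    HasGradTrace Ω v Gv k →
      massForm Ω ρ (u' t) v - massForm Ω ρ (u' s) v + ∫ r in s..t, elasticForm Ω mu lam (G r) Gv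
        = ∫ r in s..t, ∫ x, inner ℝ (τ r x) (k x) ∂(surf Ω)

variable {u u' w w' : ℝ → L2Vec Ω} {G H : ℝ → L2Mat Ω} {f g τ σ : ℝ → Sp d → Sp d}

theorem GreenCurve.restrict [IsFiniteMeasure (surf Ω)] (hu : GreenCurve Ω ρ mu lam S u u' G g τ)
    (hT : T ≤ S) : GreenCurve Ω ρ mu lam T u u' G g τ := by
  have hsub : Icc 0 T ⊆ Icc 0 S := Icc_subset_Icc_right hT
  exact ⟨fun t ht => (hu.hasDeriv t (hsub ht)).mono hsub, hu.cont_deriv.mono hsub,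
    hu.cont_grad.mono hsub, fun t ht => hu.trace t (hsub ht),
    hu.cont_trace.mono (prod_mono hsub Subset.rfl), hu.memL2_traction.mono hT,
    fun s hs t ht => hu.green s (hsub hs) t (hsub ht)⟩

theorem massForm_neg_left (v w : L2Vec Ω) : massForm Ω ρ (-v) w = -massForm Ω ρ v w := by
  rw [massForm, massForm, ← integral_neg]
  refine integral_congr_ae ?_
  filter_upwards [Lp.coeFn_neg v] with x hx
  rw [hx, Pi.neg_apply, inner_neg_left, neg_mul]

/-- The equation is of second order in time with time-independent coefficients. In `green` the sign
of the velocity is offset by the exchange of the two endpoints, so the traction keeps its sign. No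
initial condition is part of `GreenCurve`, hence none can be lost. -/
theorem GreenCurve.reverse [IsFiniteMeasure (surf Ω)] (hu : GreenCurve Ω ρ mu lam S u u' G g τ) :
    GreenCurve Ω ρ mu lam S (fun t => u (S - t)) (fun t => -u' (S - t)) (fun t => G (S - t))
      (fun t => g (S - t)) (fun t => τ (S - t)) := by
  have hmaps : MapsTo (fun t : ℝ => S - t) (Icc 0 S) (Icc 0 S) := fun t ht =>
    ⟨by linarith [ht.2], by linarith [ht.1]⟩
  have hc : ContinuousOn (fun t : ℝ => S - t) (Icc 0 S) := by fun_prop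
  refine ⟨fun t ht => ?_, (hu.cont_deriv.comp hc hmaps).neg, hu.cont_grad.comp hc hmaps,
    fun t ht => hu.trace _ (hmaps ht), ?_, hu.memL2_traction.comp_sub,
    fun s hs t ht hst v Gv k hv => ?_⟩
  · have h1 : HasDerivWithinAt (fun t : ℝ => S - t) (-1) (Icc 0 S) t :=
      (hasDerivWithinAt_id t _).const_sub S
    have h2 := (hu.hasDeriv _ (hmaps ht)).scomp t h1 hmaps
    rwa [neg_one_smul] at h2
  · exact hu.cont_trace.comp (f := fun z : ℝ × Sp d => (S - z.1, z.2)) (by fun_prop)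
      fun z hz => ⟨hmaps hz.1, hz.2⟩
  · have h1 := hu.green _ (hmaps ht) _ (hmaps hs) (by linarith) v Gv k hv
    rw [massForm_neg_left, massForm_neg_left,
      intervalIntegral.integral_comp_sub_left (fun r => elasticForm Ω mu lam (G r) Gv),
      intervalIntegral.integral_comp_sub_left (fun r => ∫ x, inner ℝ (τ r x) (k x) ∂(surf Ω)),
      ← h1]
    ring

theorem MemL2Bdry.integrableOn_inner_const [IsFiniteMeasure (surf Ω)] (hτ : MemL2Bdry Ω S τ)
    {k : Sp d → Sp d} (hk : MemLp k 2 (surf Ω)) :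
    IntegrableOn (fun r => ∫ x, inner ℝ (τ r x) (k x) ∂(surf Ω)) (Ioo 0 S) := by
  have hk' : MemL2Bdry Ω S fun _ => k := hk.comp_snd _
  exact (hτ.integrable_inner hk').integral_prod_left

/-- The second curve, with its trace, is the moving test function. The interior integrand that
remains is symmetric in the two curves, so it cancels when their roles are exchanged. -/
theorem GreenCurve.bdryInner_eq [IsFiniteMeasure (surf Ω)] (hS : 0 ≤ S) (hΩ : IsCompact Ω)
    (hmed : IsMedium Ω ρ mu lam) (hu : GreenCurve Ω ρ mu lam S u u' G f τ)
    (hw : GreenCurve Ω ρ mu lam S w w' H g σ) :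
    massForm Ω ρ (u' S) (w S) - massForm Ω ρ (u' 0) (w 0) =
      (∫ r in (0 : ℝ)..S, (massForm Ω ρ (u' r) (w' r) - elasticForm Ω mu lam (G r) (H r)))
        + bdryInner Ω S τ g := by
  obtain ⟨m, hm⟩ := exists_massForm_eq hΩ hmed
  obtain ⟨a, ha⟩ := exists_elasticForm_eq hΩ hmed
  have hg : MemL2Bdry Ω S g := memL2Bdry_of_continuousOn hΩ hw.cont_trace
  have hτ1 : Integrable (Function.uncurry τ) ((volume.restrict (Ioo 0 S)).prod (surf Ω)) :=
    MemLp.integrable one_le_two hu.memL2_traction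
  have hbb : IntegrableOn (fun r => ∫ x, inner ℝ (τ r x) (g r x) ∂(surf Ω)) (Ioo 0 S) :=
    (hu.memL2_traction.integrable_inner hg).integral_prod_left
  have hK : IsCompact (Icc 0 S ×ˢ frontier Ω) := isCompact_Icc.prod (isCompact_frontier hΩ)
  have key := bilinear_integration_by_parts m a
    (b := fun r t => ∫ x, inner ℝ (τ r x) (g t x) ∂(surf Ω)) (c := fun r => ∫ x, ‖τ r x‖ ∂(surf Ω))
    hS hu.cont_deriv hu.cont_grad hw.hasDeriv hw.cont_deriv hw.cont_grad
    (fun t ht => hu.memL2_traction.integrableOn_inner_const (hw.trace t ht).1) hbb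
    hτ1.norm.integral_prod_left (fun ε hε => ?_) (fun s hs t ht hst => ?_)
  · have h0mem : (0 : ℝ) ∈ Icc 0 S := ⟨le_rfl, hS⟩
    have hSmem : S ∈ Icc 0 S := ⟨hS, le_rfl⟩
    have i1 : IntervalIntegrable (fun r => m (u' r) (w' r) - a (G r) (H r)) volume 0 S :=
      intervalIntegrable_of_continuousOn_Icc
        (((m.continuous.comp_continuousOn hu.cont_deriv).clm_apply hw.cont_deriv).sub
          ((a.continuous.comp_continuousOn hu.cont_grad).clm_apply hw.cont_grad)) h0mem hSmem
    rw [intervalIntegral.integral_add i1 (intervalIntegrable_of_integrable_Ioo hbb h0mem hSmem)]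
      at key
    simp only [hm, ha]
    exact key
  -- Uniform continuity of the trace on the compact lateral boundary bounds the oscillation by ε
  -- times the L¹(∂Ω) norm of τ(r).
  · obtain ⟨δ, hδ, h⟩ := exists_uniform_dist_lt hK hw.cont_trace hε
    refine ⟨δ, hδ, ?_⟩
    filter_upwards [hτ1.prod_right_ae, ae_restrict_mem measurableSet_Ioo,
      (hu.memL2_traction.integrable_inner hg).prod_right_ae] with r hr hrmem hrg t ht hrt
    have hrmem' : r ∈ Icc 0 S := Ioo_subset_Icc_self hrmem
    have hgt : Integrable (fun x => inner ℝ (τ r x) (g t x)) (surf Ω) := by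
      obtain ⟨C, hC⟩ := hK.exists_bound_of_continuousOn hw.cont_trace
      refine innerL.integrable_of_bilin_of_bdd_right C hr (hw.trace t ht).1.1 ?_
      filter_upwards [ae_surf_mem_frontier] with x hx using hC (t, x) ⟨ht, hx⟩
    rw [← integral_sub hgt hrg, ← integral_const_mul, ← Real.norm_eq_abs]
    refine norm_integral_le_of_norm_le (hr.norm.const_mul ε) ?_
    filter_upwards [ae_surf_mem_frontier] with x hx
    rw [← inner_sub_right]
    refine (norm_inner_le_norm _ _).trans ?_
    rw [mul_comm]
    have h1 := h (t, x) ⟨ht, hx⟩ (r, x) ⟨hrmem', hx⟩ (by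
      rw [Prod.dist_eq, dist_self, Real.dist_eq, abs_sub_comm]
      exact max_lt hrt hδ)
    rw [dist_eq_norm] at h1
    exact mul_le_mul_of_nonneg_right h1.le (norm_nonneg _)
  · have := hu.green s hs t ht hst _ _ _ (hw.trace t ht)
    simpa only [hm, ha] using this

/-- The symmetric Green formula. -/
theorem GreenCurve.massForm_sub_eq [IsFiniteMeasure (surf Ω)] (hS : 0 ≤ S) (hΩ : IsCompact Ω)
    (hmed : IsMedium Ω ρ mu lam) (hu : GreenCurve Ω ρ mu lam S u u' G f τ)
    (hw : GreenCurve Ω ρ mu lam S w w' H g σ) :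
    massForm Ω ρ (u' S) (w S) - massForm Ω ρ (u' 0) (w 0)
        - (massForm Ω ρ (w' S) (u S) - massForm Ω ρ (w' 0) (u 0)) =
      bdryInner Ω S τ g - bdryInner Ω S σ f := by
  rw [hu.bdryInner_eq hS hΩ hmed hw, hw.bdryInner_eq hS hΩ hmed hu]
  simp only [massForm_comm (w' _) (u' _), elasticForm_comm (H _) (G _)]
  ring

/-- The weak solution and its traction each come with their own velocity and gradient. They agree by
uniqueness of derivatives and of weak gradients, so one pair carries both the trace and Green's
formula. -/
theorem exists_greenCurve (hd : 1 ≤ d) (hΩ : IsCompact Ω) (hbd : HasC1Boundary Ω)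
    (hmed : IsMedium Ω ρ mu lam) (hS : 0 < S)
    (hg : ContinuousOn (Function.uncurry g) (Icc 0 S ×ˢ frontier Ω))
    (hu : IsWeakSolution Ω ρ mu lam S g u) (hτ : IsSurfaceTraction Ω ρ mu lam S u τ) :
    ∃ u' G, GreenCurve Ω ρ mu lam S u u' G g τ ∧ u 0 = 0 ∧ u' 0 = 0 := by
  have hsurf := isFiniteMeasure_surf hd hΩ hbd
  obtain ⟨a, ha⟩ := exists_elasticForm_eq hΩ hmed
  obtain ⟨u', G, hc, hu0, hu'0, htr, -⟩ := hu
  obtain ⟨hmem, u₂', G₂, hc₂, hgreen⟩ := hτ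
  have hu' : ∀ t ∈ Icc 0 S, u₂' t = u' t := fun t ht =>
    (uniqueDiffOn_Icc hS t ht).eq_deriv _ (hc₂.hasDeriv t ht) (hc.hasDeriv t ht)
  have hG : ∀ t ∈ Icc 0 S, G₂ t = G t := fun t ht => by
    obtain ⟨k, hk⟩ := hc₂.memH1 t ht
    exact hk.grad_unique hd hΩ hbd (htr t ht)
  refine ⟨u', G, ⟨hc.hasDeriv, hc.cont_deriv, hc.cont_grad, htr, hg, hmem,
    fun s hs t ht hst v Gv k hv => ?_⟩, hu0, hu'0⟩
  have h0mem : (0 : ℝ) ∈ Icc 0 S := ⟨le_rfl, hS.le⟩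
  have e1 := hgreen s hs v Gv k hv
  have e2 := hgreen t ht v Gv k hv
  rw [hu' s hs] at e1
  rw [hu' t ht] at e2
  have ia : ∀ r ∈ Icc 0 S, IntervalIntegrable (fun r => elasticForm Ω mu lam (G₂ r) Gv)
      volume 0 r := fun r hr => by
    simp only [ha]
    exact intervalIntegrable_of_continuousOn_Icc
      ((a.flip Gv).continuous.comp_continuousOn hc₂.cont_grad) h0mem hr
  have iτ : ∀ r ∈ Icc 0 S, IntervalIntegrable (fun r => ∫ x, inner ℝ (τ r x) (k x) ∂(surf Ω))
      volume 0 r := fun r hr =>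
    intervalIntegrable_of_integrable_Ioo (hmem.integrableOn_inner_const hv.1) h0mem hr
  have e3 : ∫ r in s..t, elasticForm Ω mu lam (G r) Gv =
      ∫ r in s..t, elasticForm Ω mu lam (G₂ r) Gv := by
    refine intervalIntegral.integral_congr fun r hr => ?_
    rw [hG r (uIcc_subset_Icc hs ht hr)]
  rw [e3, ← intervalIntegral.integral_interval_sub_left (ia t ht) (ia s hs),
    ← intervalIntegral.integral_interval_sub_left (iτ t ht) (iτ s hs), ← e1, ← e2]
  ring

/-! ### Time averaging in boundary pairings, and the final identity -/

theorem bdryInner_comm (f g : ℝ → Sp d → Sp d) : bdryInner Ω S f g = bdryInner Ω S g f := by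
  simp only [bdryInner, real_inner_comm]

/-- This writes BΘh through the primitive P, reflected minus unreflected: the boundary data that the
two Green formulas produce. -/
theorem timeAvg_extendZero_eq (hT : 0 < T) (hf : IsSource Ω T f) {t : ℝ} (ht : t ∈ Icc 0 T)
    {x : Sp d} (hx : x ∈ frontier Ω) :
    timeAvg T (extendZero T f) t x =
      timeAvgDeriv T (timePrimitive (extendZero T f)) t x :=
  (timeAvgDeriv_timePrimitive T _ x (hf.intervalIntegrable_extendZero hx _ _)
    ⟨ht.1, by linarith [ht.2]⟩).symm

theorem bdryInner_timeAvgDeriv [IsFiniteMeasure (surf Ω)] (hT : 0 < T) {N : ℝ → Sp d → Sp d}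
    (hf : MemL2Bdry Ω T f) (hN : MemL2Bdry Ω (2 * T) N) :
    bdryInner Ω T f (timeAvgDeriv T N) =
      (1 / 2) * (bdryInner Ω T f (fun t => N (2 * T - t)) - bdryInner Ω T f N) := by
  have hle : T ≤ 2 * T := by linarith
  rw [← bdryInner_sub_right hT.le hf (hN.comp_sub.mono hle) (hN.mono hle),
    ← bdryInner_smul_right]
  rfl

theorem MemL2Bdry.timeAvgDeriv [IsFiniteMeasure (surf Ω)] (hT : 0 < T) {N : ℝ → Sp d → Sp d}
    (hN : MemL2Bdry Ω (2 * T) N) : MemL2Bdry Ω T (timeAvgDeriv T N) := by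
  have hle : T ≤ 2 * T := by linarith
  exact (MemLp.sub (hN.comp_sub.mono hle) (hN.mono hle)).const_smul (1 / 2 : ℝ)

end Elastic

end

open Elastic in
theorem mainTheorem7 {d : ℕ} (hd : 3 ≤ d) (Ω : Set (Sp d)) (hΩ : IsCompact Ω)
    (hbd : HasC1Boundary Ω) (ρ mu lam : Sp d → ℝ) (hmed : IsMedium Ω ρ mu lam)
    (T : ℝ) (hT : 0 < T) (f h : ℝ → Sp d → Sp d) (hf : IsSource Ω T f) (hh : IsSource Ω T h)
    (uf uh : ℝ → L2Vec Ω) (huf : IsWeakSolution Ω ρ mu lam T f uf)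
    (huh : IsWeakSolution Ω ρ mu lam T h uh)
    (Λf : ℝ → Sp d → Sp d) (hΛf : IsTractionMap Ω ρ mu lam T f Λf)
    (Jh : ℝ → Sp d → Sp d) (hJh : IsConnectingMap Ω ρ mu lam T h Jh) :
    massForm Ω ρ (uf T) (uh T) = bdryInner Ω T f Jh := by
  have hd1 : 1 ≤ d := by omega
  have hle : T ≤ 2 * T := by linarith
  have hTT : 2 * T - T = T := by ring
  have hTmem : T ∈ Icc 0 T := ⟨hT.le, le_rfl⟩
  have hsurf := isFiniteMeasure_surf hd1 hΩ hbd
  obtain ⟨κ, N, ⟨-, hκ, hadj⟩, ⟨w, hw, hwN⟩, rfl⟩ := hJh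
  have hadj := hadj f Λf hf hΛf
  obtain ⟨u, hu, huΛ⟩ := hΛf
  have hP := hh.continuousOn_timePrimitive (S := 2 * T) hT.le
  have hfL2 : MemL2Bdry Ω T f := memL2Bdry_of_continuousOn hΩ hf.continuousOn
  obtain ⟨u', G, U, hu0, hu'0⟩ := exists_greenCurve hd1 hΩ hbd hmed hT hf.continuousOn hu huΛ
  obtain ⟨w', H, W, -, -⟩ := exists_greenCurve hd1 hΩ hbd hmed (by linarith) hP hw hwN
  have hvel : w' T = uh T := by
    refine (uniqueDiffOn_Icc hT T hTmem).eq_deriv _ ((W.restrict hle).hasDeriv T hTmem) ?_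
    refine huh.primitive_hasDerivWithinAt hd1 hΩ hbd hmed hle hh.continuousOn
      (fun t ht x _ => ?_) hw hTmem
    rw [timePrimitive_extendZero ht.1 hT.le, min_eq_left ht.2]
  have h1 := U.massForm_sub_eq hT.le hΩ hmed (W.restrict hle)
  -- The reflection is taken about T, on the whole of [0, 2T], and then cut to [0, T]: at time T it
  -- has the value `w T` and the velocity `-w' T`.
  have h2 := U.massForm_sub_eq hT.le hΩ hmed (W.reverse.restrict hle)
  simp only [hTT, massForm_neg_left] at h2
  have hz : ∀ v : L2Vec Ω, massForm Ω ρ 0 v = 0 := fun v => by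
    obtain ⟨m, hm⟩ := exists_massForm_eq hΩ hmed
    rw [hm, map_zero, zero_apply]
  -- All terms at time 0 contain u(0) or u'(0), so the unknown state of `w` at time 2T drops out.
  rw [hu0, hu'0, massForm_comm _ 0, hz, hz] at h1 h2
  rw [hvel, bdryInner_comm _ f] at h1 h2
  have h3 : bdryInner Ω T f κ = _ := hadj.symm.trans
    ((bdryInner_congr hT.le (fun _ _ _ _ => rfl) fun t ht x hx =>
      timeAvg_extendZero_eq hT hh ht hx).trans
      (bdryInner_timeAvgDeriv hT huΛ.1 (memL2Bdry_of_continuousOn hΩ hP)))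
  -- What remains is half of `h2` minus `h1`, once `uf` is identified with the solution underlying
  -- `Λf`.
  rw [bdryInner_sub_right hT.le hfL2 hκ (hwN.1.timeAvgDeriv hT),
    bdryInner_timeAvgDeriv hT hfL2 hwN.1, h3, huf.unique hd1 hΩ hmed hu hTmem, massForm_comm]
  linarith
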